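/- Let $r\in\mathbb N$. For a multi-index $\vec n=(n_1,\dots,n_r)\in\mathbb N^r$ (with $0\in\mathbb N$) put $|\vec n|=n_1+\dots+n_r$, and let $\vec e_k$ be the $k$-th unit vector. Given positive Borel measures $\mu_1,\dots,\mu_r$ on $\mathbb R$, the multi-index $\vec n$ is called normal if there is exactly one monic polynomial $P_{\vec n}$ of degree $|\vec n|$ with $$\int_{\mathbb R} x^k P_{\vec n}(x)\,d\mu_j(x)=0\qquad (0\le k\le n_j-1,\ 1\le j\le r)$$ (absolutely convergent integrals); $P_{\vec n}$ is then the type II multiple orthogonal polynomial, and $P_{\vec n-\vec e_j}:=0$ if $n_j=0$. The zeros of $P_{\vec n}$ and $P_{\vec n+\vec e_k}$ are said to interlace if all zeros of both polynomials are real and simple and, writing $x_1<\dots<x_m$ ($m=|\vec n|$) for those of $P_{\vec n}$ and $y_1<\dots<y_{m+1}$ for those of $P_{\vec n+\vec e_k}$, one has $y_i<x_i<y_{i+1}$ for $1\le i\le m$. Write $\delta_k$ for the unit mass at $k$ and $(\beta)_k=\beta(\beta+1)\cdots(\beta+k-1)$. (A) In each of the following five cases all multi-indices $\vec n$ (in case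 4: all $\vec n$ with $|\vec n|\le N+1$) are normal. Moreover, for every $\vec n$ (in case 4: every $\vec n$ with $|\vec n|\le N$), the nearest neighbor recurrence relations $$xP_{\vec n}(x)=P_{\vec n+\vec e_k}(x)+b_{\vec n,k}P_{\vec n}(x)+\sum_{j=1}^r a_{\vec n,j}P_{\vec n-\vec e_j}(x)\qquad(1\le k\le r)$$ hold with the stated coefficients, $a_{\vec n,j}>0$ whenever $n_j>0$, and the zeros of $P_{\vec n}$ and $P_{\vec n+\vec e_k}$ interlace for every $1\le k\le r$. 1. Multiple Hermite: $d\mu_j=e^{-x^2+c_jx}\,dx$ on $\mathbb R$, with $c_1,\dots,c_r$ distinct reals; $b_{\vec n,k}=c_k/2$, $a_{\vec n,j}=n_j/2$. 2. Multiple Charlier: $\mu_j=\sum_{k\ge0}\frac{a_j^k}{k!}\delta_k$, with $a_1,\dots,a_r>0$ distinct; $b_{\vec n,k}=a_k+|\vec n|$, $a_{\vec n,j}=a_jn_j$. 3. Multiple Meixner of the first kind: $\mu_j=\sum_{k\ge0}\frac{(\beta)_kc_j^k}{k!}\delta_k$, with $\beta>0$ and $0<c_j<1$ distinct; $b_{\vec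 n,k}=(|\vec n|+\beta)\frac{c_k}{1-c_k}+\sum_{i=1}^r\frac{n_i}{1-c_i}$, $a_{\vec n,j}=c_jn_j\frac{\beta+|\vec n|-1}{(1-c_j)^2}$. 4. Multiple Krawtchouk: $\mu_j=\sum_{k=0}^N\binom Nk p_j^k(1-p_j)^{N-k}\delta_k$, with $N\in\mathbb N$ and $0<p_j<1$ distinct; $b_{\vec n,k}=(N-|\vec n|)p_k+\sum_{i=1}^rn_i(1-p_i)$, $a_{\vec n,j}=\frac{p_j}{p_j-1}\,n_j\,\frac{|\vec n|-N-1}{(-1/(p_j-1))^2}$. 5. Multiple Laguerre of the second kind: $d\mu_j=x^\alpha e^{-c_jx}\,dx$ on $[0,\infty)$, with $\alpha>-1$ and $c_j>0$ distinct; $b_{\vec n,k}=\frac{|\vec n|+1+\alpha}{c_k}+\sum_{i=1}^r\frac{n_i}{c_i}$, $a_{\vec n,j}=\frac{n_j}{c_j^2}(|\vec n|+\alpha)$. (B) Call $(\mu_1,\dots,\mu_r)$ an AT system on an interval $I$ if there are a measure $\nu$ on $I$ and nonnegative continuous functions $w_1,\dots,w_r$ on $I$ with $d\mu_j=w_j\,d\nu$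 such that, for every $\vec n$, the functions $x^iw_j(x)$ ($0\le i\le n_j-1$, $1\le j\le r$) form a Chebyshev system on $I$: every nontrivial linear combination of these $|\vec n|$ functions has at most $|\vec n|-1$ zeros on $I$. In each of the following two cases the measures form an AT system on the stated interval $I$, all multi-indices are normal, and for all $\vec n$ and all $1\le k\le r$ the zeros of $P_{\vec n}$ and $P_{\vec n+\vec e_k}$ interlace. 6. Multiple Laguerre of the first kind: $d\mu_j=x^{\alpha_j}e^{-x}\,dx$ on $[0,\infty)$, with $\alpha_j>-1$ and $\alpha_i-\alpha_j\notin\mathbb Z$ for $i\ne j$; $I=(0,\infty)$. 7. Multiple Meixner of the second kind: $\mu_j=\sum_{k\ge0}\frac{(\beta_j)_kc^k}{k!}\delta_k$, with $0<c<1$, $\beta_j>0$ and $\beta_i-\beta_j\notin\mathbb Z$ for $i\ne j$; $I=[0,\infty)$. -/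

import Mathlib

open MeasureTheory Polynomial

namespace MOP

noncomputable section

variable {r : ℕ}

/-- `P` is monic of degree `|n| = n₁ + ⋯ + n_r` and satisfies
`∫ x ^ k * P x dμ_j = 0` for `0 ≤ k ≤ n_j - 1` and `1 ≤ j ≤ r` (the integrals being
absolutely convergent). -/
def IsTypeII (μ : Fin r → Measure ℝ) (n : Fin r → ℕ) (P : ℝ[X]) : Prop :=
  P.Monic ∧ P.natDegree = ∑ j, n j ∧
    ∀ j, ∀ k < n j, Integrable (fun x : ℝ => x ^ k * P.eval x) (μ j) ∧
      ∫ x : ℝ, x ^ k * P.eval x ∂(μ j) = 0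

/-- The multi-index `n` is normal: the type II polynomial exists and is unique. -/
def IsNormal (μ : Fin r → Measure ℝ) (n : Fin r → ℕ) : Prop :=
  ∃! P : ℝ[X], IsTypeII μ n P

open Classical in
/-- The type II multiple orthogonal polynomial `P_n` (with the value `0` for a multi-index that
is not normal). -/
def poly (μ : Fin r → Measure ℝ) (n : Fin r → ℕ) : ℝ[X] :=
  if h : IsNormal μ n then h.choose else 0

/-- The upper neighbour `P_{n + e_k}`. -/
def upperPoly (μ : Fin r → Measure ℝ) (n : Fin r → ℕ) (k : Fin r) : ℝ[X] :=
  poly μ (n + Pi.single k 1)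

/-- The lower neighbour `P_{n - e_j}`, which is `0` by convention when `n_j = 0`. -/
def lowerPoly (μ : Fin r → Measure ℝ) (n : Fin r → ℕ) (j : Fin r) : ℝ[X] :=
  if n j = 0 then 0 else poly μ (n - Pi.single j 1)

/-- All zeros of `p` and of `q` are real and simple, `deg q = deg p + 1`, and the zeros
`x₁, …, x_m` of `p` and `y₁, …, y_{m+1}` of `q` satisfy `y₁ < x₁ < y₂ < ⋯ < x_m < y_{m+1}`. -/
def Interlace (p q : ℝ[X]) : Prop :=
  ∃ (m : ℕ) (x : Fin m → ℝ) (y : Fin (m + 1) → ℝ),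
    p ≠ 0 ∧ p.natDegree = m ∧ q.natDegree = m + 1 ∧
    p.roots = Finset.univ.val.map x ∧ q.roots = Finset.univ.val.map y ∧
    ∀ i : Fin m, y i.castSucc < x i ∧ x i < y i.succ

/-- The nearest neighbour recurrence relations at the multi-index `n`:
`x P_n = P_{n + e_k} + b_k P_n + ∑ j, a_j P_{n - e_j}` for `k = 1, …, r`. -/
def NearestNeighborRecurrence (μ : Fin r → Measure ℝ) (n : Fin r → ℕ) (b a : Fin r → ℝ) : Prop :=
  ∀ k, X * poly μ n =
    upperPoly μ n k + C (b k) * poly μ n + ∑ j, C (a j) * lowerPoly μ n j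

/-- `{w₁, x w₁, …, x ^ (n₁ - 1) w₁, w₂, …, x ^ (n_r - 1) w_r}` is a Chebyshev system on `I`:
the functions are continuous, and every nontrivial linear combination of these `|n|` functions
has at most `|n| - 1` zeros on `I`. -/
def IsChebyshev (I : Set ℝ) (w : Fin r → ℝ → ℝ) (n : Fin r → ℕ) : Prop :=
  (∀ j, ContinuousOn (w j) I) ∧
    ∀ A : Fin r → ℝ[X], (∀ j, (A j).degree < (n j : WithBot ℕ)) → A ≠ 0 →
      {x ∈ I | ∑ j, (A j).eval x * w j x = 0}.encard < ((∑ j, n j : ℕ) : ℕ∞)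

/-- `(μ₁, …, μ_r)` is an AT system on the interval `I`: there is a measure `ν` on `I` with
`dμ_j = w_j dν`, and the weights form Chebyshev systems on `I` for all multi-indices. -/
def IsATSystem (μ : Fin r → Measure ℝ) (I : Set ℝ) : Prop :=
  I.OrdConnected ∧ ∃ (ν : Measure ℝ) (w : Fin r → ℝ → ℝ),
    ν Iᶜ = 0 ∧ (∀ j, Measurable (w j)) ∧ (∀ j, ∀ x ∈ I, 0 ≤ w j x) ∧
    (∀ j, μ j = ν.withDensity (fun x => ENNReal.ofReal (w j x))) ∧
    ∀ n : Fin r → ℕ, IsChebyshev I w n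

/-- `e ^ (- x² + c x) dx` on the real line. -/
def hermiteMeasure (c : ℝ) : Measure ℝ :=
  volume.withDensity fun x => ENNReal.ofReal (Real.exp (-x ^ 2 + c * x))

/-- `∑ k, a ^ k / k! δ_k`. -/
def charlierMeasure (a : ℝ) : Measure ℝ :=
  Measure.sum fun k : ℕ => ENNReal.ofReal (a ^ k / (k.factorial : ℝ)) • Measure.dirac (k : ℝ)

/-- `∑ k, (β)_k c ^ k / k! δ_k`, where `(β)_k = β (β + 1) ⋯ (β + k - 1)`. -/
def meixnerMeasure (β c : ℝ) : Measure ℝ :=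
  Measure.sum fun k : ℕ =>
    ENNReal.ofReal ((ascPochhammer ℝ k).eval β * c ^ k / (k.factorial : ℝ)) •
      Measure.dirac (k : ℝ)

/-- The binomial measure `∑_{k ≤ N} (N choose k) p ^ k (1 - p) ^ (N - k) δ_k`. -/
def krawtchoukMeasure (N : ℕ) (p : ℝ) : Measure ℝ :=
  ∑ k ∈ Finset.range (N + 1),
    ENNReal.ofReal ((N.choose k : ℝ) * p ^ k * (1 - p) ^ (N - k)) • Measure.dirac (k : ℝ)

/-- `x ^ α e ^ (- c x) dx` on `[0, ∞)`. -/
def laguerreMeasure (α c : ℝ) : Measure ℝ :=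
  (volume.restrict (Set.Ici 0)).withDensity
    fun x => ENNReal.ofReal (x ^ α * Real.exp (-(c * x)))

/-! The coefficients `b_{n,k}` and `a_{n,j}` of the nearest neighbour recurrence relations. -/

def hermiteB (c : Fin r → ℝ) (_n : Fin r → ℕ) (k : Fin r) : ℝ := c k / 2

def hermiteA (n : Fin r → ℕ) (j : Fin r) : ℝ := (n j : ℝ) / 2

def charlierB (a : Fin r → ℝ) (n : Fin r → ℕ) (k : Fin r) : ℝ := a k + ∑ i, (n i : ℝ)

def charlierA (a : Fin r → ℝ) (n : Fin r → ℕ) (j : Fin r) : ℝ := a j * n j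

def meixnerB (β : ℝ) (c : Fin r → ℝ) (n : Fin r → ℕ) (k : Fin r) : ℝ :=
  ((∑ i, (n i : ℝ)) + β) * (c k / (1 - c k)) + ∑ i, (n i : ℝ) / (1 - c i)

def meixnerA (β : ℝ) (c : Fin r → ℝ) (n : Fin r → ℕ) (j : Fin r) : ℝ :=
  c j * n j * ((β + (∑ i, (n i : ℝ)) - 1) / (1 - c j) ^ 2)

def krawtchoukB (N : ℕ) (p : Fin r → ℝ) (n : Fin r → ℕ) (k : Fin r) : ℝ :=
  ((N : ℝ) - ∑ i, (n i : ℝ)) * p k + ∑ i, (n i : ℝ) * (1 - p i)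

def krawtchoukA (N : ℕ) (p : Fin r → ℝ) (n : Fin r → ℕ) (j : Fin r) : ℝ :=
  p j / (p j - 1) * n j * (((∑ i, (n i : ℝ)) - N - 1) / (-1 / (p j - 1)) ^ 2)

def laguerreB (α : ℝ) (c : Fin r → ℝ) (n : Fin r → ℕ) (k : Fin r) : ℝ :=
  ((∑ i, (n i : ℝ)) + 1 + α) / c k + ∑ i, (n i : ℝ) / c i

def laguerreA (α : ℝ) (c : Fin r → ℝ) (n : Fin r → ℕ) (j : Fin r) : ℝ :=
  (n j : ℝ) / c j ^ 2 * ((∑ i, (n i : ℝ)) + α)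

end

end MOP

/-! Normality and interlacing both come from counting sign changes. In a Chebyshev system of `m + 1`
functions some combination changes sign exactly at `m` prescribed points. So a polynomial orthogonal
to an AT system at index `n` either has at least `|n|` sign changes or vanishes almost everywhere:
otherwise its product with a suitable combination has constant sign and zero integral. For degree
below `|n|` this forces the zero polynomial, and the square linear system for `P_n` is uniquely
solvable. Every nontrivial combination of `P_n` and `P_{n + e_k}` has degree at most `|n| + 1` and
satisfies the orthogonality at `n`, hence has only real simple zeros. A zero of the Wronskian would
give some combination a double zero, so the Wronskian never vanishes, and Rolle applied to `P_{n +
e_k} / P_n` yields interlacing (`interlace_of_pencil`, `IsATSystem.isNormal_and_interlace`).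

The AT property rests on zero counts. In cases 1 to 5 the weights are multiples of `e ^ (c_j x)`
against a common measure, and exponential polynomials are handled by Rolle. The weights `x ^ α_j`
reduce to exponential sums by `x = e ^ t`. For Meixner of the second kind the weights are `Γ (x +
β_j)` up to constants; a polynomial combination of them is a Mellin transform of `∑ q_j(t) t ^ β_j e
^ (-t)`, which has fewer than `|n|` zeros, and the Mellin transform does not increase the number of
sign changes.

The recurrences use one linear map `T` common to all measures of an exponential family: `∫ q dμ_j =
K_j (T q)(z_j)`, where `T` turns multiplication by `x` into `l z + (s₂ z² + s₁ z + s₀) d/dz`.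
Heuristically this operator is differentiation in the exponential parameter, rewritten in the
variable `z`. It is of first order, so orthogonality at `n` follows when `T P` is divisible by `∏ (z
- z_j) ^ n_j`. Applying the operator to this product and expanding at the nodes gives the
recurrence, coefficients included (`raisingOp_nodePoly`). The resulting polynomials are built
recursively and identified with `P_n` by normality. -/

namespace MOP

/-! ### Chebyshev systems and sign changes -/

/-- `u` is a Chebyshev system of continuous functions on `I`. -/
def IsTSystem {N : ℕ} (I : Set ℝ) (u : Fin N → ℝ → ℝ) : Prop :=
  (∀ i, ContinuousOn (u i) I) ∧
    ∀ a : Fin N → ℝ, a ≠ 0 → {x ∈ I | ∑ i, a i * u i x = 0}.encard < (N : ℕ∞)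

/-- A left null vector of the matrix would be a nontrivial combination vanishing at `N` distinct
points of `I`. -/
theorem IsTSystem.det_ne_zero {N : ℕ} {I : Set ℝ} {u : Fin N → ℝ → ℝ} (hu : IsTSystem I u)
    {y : Fin N → ℝ} (hy : Function.Injective y) (hyI : ∀ i, y i ∈ I) :
    (Matrix.of fun i j => u i (y j)).det ≠ 0 := by
  intro h
  obtain ⟨a, ha, h0⟩ := Matrix.exists_vecMul_eq_zero_iff.mpr h
  have h1 := hu.2 a ha
  have h2 : Set.range y ⊆ {x ∈ I | ∑ i, a i * u i x = 0} := by
    rintro _ ⟨j, rfl⟩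
    refine ⟨hyI j, ?_⟩
    have := congrFun h0 j
    simpa [Matrix.vecMul, dotProduct] using this
  have h3 := Set.encard_le_encard h2
  rw [← Set.image_univ, hy.encard_image, Set.encard_univ] at h3
  simp at h3
  exact absurd h1 (not_lt.mpr h3)

theorem det_vandermonde_pos_of_strictMono {N : ℕ} {y : Fin N → ℝ} (hy : StrictMono y) :
    0 < (Matrix.vandermonde y).det := by
  rw [Matrix.det_vandermonde]
  exact Finset.prod_pos fun i _ => Finset.prod_pos fun j hj =>
    sub_pos.mpr (hy (Finset.mem_Ioi.mp hj))

/-- The increasing tuples in an interval form a convex, hence connected, set on which the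
determinant is continuous and never zero. -/
theorem IsTSystem.det_sign_of_strictMono {N : ℕ} {I : Set ℝ} (hI : I.OrdConnected)
    {u : Fin N → ℝ → ℝ} (hu : IsTSystem I u) :
    ∃ ε : ℝ, ∀ y : Fin N → ℝ, StrictMono y → (∀ i, y i ∈ I) →
      0 < ε * (Matrix.of fun i j => u i (y j)).det := by
  set T : Set (Fin N → ℝ) := {y | StrictMono y ∧ ∀ i, y i ∈ I}
  have hconv : Convex ℝ T := by
    intro y hy z hz a b ha hb hab
    refine ⟨fun i j hij => ?_, fun i => ?_⟩
    · have h1 := hy.1 hij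
      have h2 := hz.1 hij
      simp only [Pi.add_apply, Pi.smul_apply, smul_eq_mul]
      rcases ha.eq_or_lt with rfl | ha
      · have : b = 1 := by linarith
        subst this; linarith
      · have := mul_lt_mul_of_pos_left h1 ha
        have := mul_le_mul_of_nonneg_left h2.le hb
        linarith
    · exact hI.convex (hy.2 i) (hz.2 i) ha hb hab
  have hcont : ContinuousOn (fun y : Fin N → ℝ => (Matrix.of fun i j => u i (y j)).det) T := by
    simp only [Matrix.det_apply]
    refine continuousOn_finsetSum _ fun σ _ => ContinuousOn.const_smul ?_ _
    refine continuousOn_finsetProd _ fun i _ => ?_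
    exact (hu.1 _).comp (continuous_apply i).continuousOn fun y hy => hy.2 i
  have hne : ∀ y ∈ T, (Matrix.of fun i j => u i (y j)).det ≠ 0 := fun y hy =>
    hu.det_ne_zero hy.1.injective hy.2
  rcases T.eq_empty_or_nonempty with h | ⟨y₀, hy₀⟩
  · exact ⟨0, fun y h1 h2 => absurd (show y ∈ T from ⟨h1, h2⟩) (by simp [h])⟩
  refine ⟨(Matrix.of fun i j => u i (y₀ j)).det, fun y h1 h2 => ?_⟩
  by_contra hcon
  have hy : y ∈ T := ⟨h1, h2⟩
  rcases lt_or_gt_of_ne (hne y₀ hy₀) with h | h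
  · obtain ⟨z, hz, h0⟩ := hconv.isPreconnected.intermediate_value hy₀ hy hcont
      (show (0 : ℝ) ∈ Set.Icc _ _ from ⟨h.le, by nlinarith⟩)
    exact hne z hz h0
  · obtain ⟨z, hz, h0⟩ := hconv.isPreconnected.intermediate_value hy hy₀ hcont
      (show (0 : ℝ) ∈ Set.Icc _ _ from ⟨by nlinarith, h.le⟩)
    exact hne z hz h0

/-- Sorting `y` multiplies both determinants by the sign of the same permutation, so their product
keeps its sign. -/
theorem IsTSystem.det_sign {N : ℕ} {I : Set ℝ} (hI : I.OrdConnected)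
    {u : Fin N → ℝ → ℝ} (hu : IsTSystem I u) :
    ∃ ε : ℝ, ∀ y : Fin N → ℝ, Function.Injective y → (∀ i, y i ∈ I) →
      0 < ε * (Matrix.of fun i j => u i (y j)).det * (Matrix.vandermonde y).det := by
  obtain ⟨ε, hε⟩ := hu.det_sign_of_strictMono hI
  refine ⟨ε, fun y hy hyI => ?_⟩
  set σ := Tuple.sort y
  have hmono : StrictMono (y ∘ σ) :=
    (Tuple.monotone_sort y).strictMono_of_injective (hy.comp σ.injective)
  have h1 := hε (y ∘ σ) hmono fun i => hyI _
  have h2 := det_vandermonde_pos_of_strictMono hmono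
  have e1 : (Matrix.of fun i j => u i ((y ∘ σ) j)).det =
      (Equiv.Perm.sign σ : ℝ) * (Matrix.of fun i j => u i (y j)).det := by
    rw [← Matrix.det_permute']; rfl
  have e2 : (Matrix.vandermonde (y ∘ σ)).det =
      (Equiv.Perm.sign σ : ℝ) * (Matrix.vandermonde y).det := by
    rw [← Matrix.det_permute]; rfl
  rw [e1] at h1
  rw [e2] at h2
  have h3 := mul_pos h1 h2
  have h4 : ((Equiv.Perm.sign σ : ℤ) : ℝ) * ((Equiv.Perm.sign σ : ℤ) : ℝ) = 1 := by
    exact_mod_cast Int.units_coe_mul_self (Equiv.Perm.sign σ)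
  calc (0 : ℝ) < _ := h3
    _ = ε * (Matrix.of fun i j => u i (y j)).det * (Matrix.vandermonde y).det *
      (((Equiv.Perm.sign σ : ℤ) : ℝ) * ((Equiv.Perm.sign σ : ℤ) : ℝ)) := by ring
    _ = _ := by rw [h4, mul_one]

/-- In a Chebyshev system of `m + 1` functions some combination changes sign exactly at `m`
prescribed points. -/
theorem IsTSystem.exists_sign_changes {m : ℕ} {I : Set ℝ} (hI : I.OrdConnected)
    {u : Fin (m + 1) → ℝ → ℝ} (hu : IsTSystem I u) {S : Finset ℝ} (hS : S.card = m)
    (hSI : ∀ s ∈ S, s ∈ I) :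
    ∃ a : Fin (m + 1) → ℝ, ∀ x ∈ I, x ∉ S → 0 < (∑ i, a i * u i x) * ∏ s ∈ S, (x - s) := by
  obtain ⟨ε, hε⟩ := hu.det_sign hI
  set s := S.orderEmbOfFin hS
  have hV := det_vandermonde_pos_of_strictMono s.strictMono
  -- The coefficients are the cofactors of the column belonging to `x` in the determinant at `x` and
  -- the points of `S`. The factor `(-1) ^ m` turns `∏ (s - x)`, which comes from the Vandermonde
  -- determinant, into `∏ (x - s)`.
  refine ⟨fun i => ε * (-1) ^ m * ((-1) ^ (i : ℕ) *
    (Matrix.of fun (k : Fin m) (j : Fin m) => u (i.succAbove k) (s j)).det), fun x hx hxS => ?_⟩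
  have hinj : Function.Injective (Fin.cons x s : Fin (m + 1) → ℝ) := by
    rw [Fin.cons_injective_iff]
    refine ⟨?_, s.injective⟩
    rintro ⟨i, rfl⟩
    exact hxS (S.orderEmbOfFin_mem hS i)
  have h := hε (Fin.cons x s) hinj fun i => by
    refine Fin.cases hx (fun i => ?_) i
    exact hSI _ (S.orderEmbOfFin_mem hS i)
  rw [Matrix.det_succ_column_zero, Matrix.det_vandermonde, Fin.prod_univ_succ] at h
  have e1 : ∏ i : Fin m, ∏ j ∈ Finset.Ioi i.succ,
      ((Fin.cons x s : Fin (m + 1) → ℝ) j - (Fin.cons x s : Fin (m + 1) → ℝ) i.succ) =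
      (Matrix.vandermonde s).det := by
    rw [Matrix.det_vandermonde]
    refine Finset.prod_congr rfl fun i _ => ?_
    rw [Fin.prod_Ioi_succ]
    simp
  have e2 : ∏ j ∈ Finset.Ioi (0 : Fin (m + 1)), ((Fin.cons x s : Fin (m + 1) → ℝ) j -
      (Fin.cons x s : Fin (m + 1) → ℝ) 0) = (-1) ^ m * ∏ t ∈ S, (x - t) := by
    rw [Fin.prod_Ioi_zero]
    have : ∏ t ∈ S, (x - t) = ∏ i : Fin m, (x - s i) := by
      rw [← Finset.image_orderEmbOfFin_univ S hS, Finset.prod_image fun a _ b _ h => s.injective h]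
    rw [this]
    have h3 : ((-1 : ℝ)) ^ m = ∏ _i : Fin m, (-1 : ℝ) := by simp
    rw [h3, ← Finset.prod_mul_distrib]
    exact Finset.prod_congr rfl fun i _ => by simp
  rw [e1, e2] at h
  rw [← mul_assoc] at h
  replace h := pos_of_mul_pos_left h hV.le
  refine h.trans_eq ?_
  rw [← mul_assoc]
  congr 1
  rw [Finset.mul_sum, Finset.sum_mul]
  refine Finset.sum_congr rfl fun i _ => ?_
  have : (Matrix.of fun (k : Fin m) (j : Fin m) => u (i.succAbove k) (s j)) =
    (Matrix.of fun i j => u i ((Fin.cons x s : Fin (m + 1) → ℝ) j)).submatrix i.succAbove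
      Fin.succ := by
    ext; simp
  beta_reduce
  rw [this, Matrix.of_apply, Fin.cons_zero]
  ring

theorem pos_or_neg_of_ne_zero {f : ℝ → ℝ} {I : Set ℝ} (hI : I.OrdConnected)
    (hf : ContinuousOn f I) (h : ∀ x ∈ I, f x ≠ 0) :
    (∀ x ∈ I, 0 < f x) ∨ ∀ x ∈ I, f x < 0 := by
  by_contra! hcon
  obtain ⟨⟨x, hx, hx'⟩, y, hy, hy'⟩ := hcon
  obtain ⟨z, hz, hz'⟩ := hI.isPreconnected.intermediate_value hx hy hf
    (show (0 : ℝ) ∈ Set.Icc _ _ from ⟨hx', hy'⟩)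
  exact h z hz hz'

/-- A continuous function with finitely many zeros on an interval has the sign of
`± ∏ (x - s)`, the product over a set of zeros. -/
theorem exists_sign_set {f : ℝ → ℝ} : ∀ (k : ℕ) {I : Set ℝ} (_hI : I.OrdConnected)
    (_hf : ContinuousOn f I) (Z : Finset ℝ) (_hZ : ∀ x ∈ I, f x = 0 → x ∈ Z) (_hk : Z.card ≤ k),
    ∃ S ⊆ Z, (∀ s ∈ S, s ∈ I ∧ f s = 0) ∧
      ((∀ x ∈ I, 0 ≤ f x * ∏ s ∈ S, (x - s)) ∨ ∀ x ∈ I, 0 ≤ -f x * ∏ s ∈ S, (x - s)) := by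
  intro k
  induction k with
  | zero =>
    intro I hI hf Z hZ hk
    have hZ0 : Z = ∅ := by simpa using hk
    subst hZ0
    refine ⟨∅, le_rfl, by simp, ?_⟩
    rcases pos_or_neg_of_ne_zero hI hf (fun x hx h => by simpa using hZ x hx h) with h | h
    · left; intro x hx; simpa using (h x hx).le
    · right; intro x hx; simpa using (h x hx).le
  | succ k ih =>
    intro I hI hf Z hZ hk
    rcases Z.eq_empty_or_nonempty with rfl | hne
    · exact ih hI hf ∅ hZ (by simp)
    -- The largest candidate is split off. To the right of `z` the product over `S` is positive and
    -- `f` has one sign; `z` joins `S` exactly when that sign disagrees with the one found on the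
    -- left.
    set z := Z.max' hne
    have hzZ : z ∈ Z := Z.max'_mem hne
    by_cases hzI : z ∈ I ∧ f z = 0
    swap
    · obtain ⟨S, hS, h⟩ := ih hI hf (Z.erase z) (fun x hx h0 => Finset.mem_erase.mpr
        ⟨fun h => hzI (h ▸ ⟨hx, h0⟩), hZ x hx h0⟩) (by rw [Finset.card_erase_of_mem hzZ]; omega)
      exact ⟨S, hS.trans (Finset.erase_subset _ _), h⟩
    obtain ⟨hzI, hz0⟩ := hzI
    obtain ⟨S, hS, hS', h⟩ := ih (hI.inter (Set.ordConnected_Iio (a := z)))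
      (hf.mono Set.inter_subset_left) (Z.erase z) (fun x hx h0 => Finset.mem_erase.mpr
        ⟨ne_of_lt hx.2, hZ x hx.1 h0⟩) (by rw [Finset.card_erase_of_mem hzZ]; omega)
    have hSz : ∀ s ∈ S, s < z := fun s hs => (hS' s hs).1.2
    have hzS : z ∉ S := fun h => lt_irrefl _ (hSz z h)
    have hpos : ∀ x, z < x → 0 < ∏ s ∈ S, (x - s) := fun x hx =>
      Finset.prod_pos fun s hs => sub_pos.mpr ((hSz s hs).trans hx)
    have hS1 : ∀ s ∈ S, s ∈ I ∧ f s = 0 := fun s hs => ⟨(hS' s hs).1.1, (hS' s hs).2⟩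
    have hS2 : ∀ s ∈ insert z S, s ∈ I ∧ f s = 0 := by
      simp only [Finset.mem_insert, forall_eq_or_imp]
      exact ⟨⟨hzI, hz0⟩, hS1⟩
    have hsub : S ⊆ Z := hS.trans (Finset.erase_subset _ _)
    have hsub2 : insert z S ⊆ Z := Finset.insert_subset hzZ hsub
    have hr := pos_or_neg_of_ne_zero (hI.inter (Set.ordConnected_Ioi (a := z))) (hf.mono Set.inter_subset_left)
      (fun x hx h0 => absurd (Z.le_max' x (hZ x hx.1 h0)) (not_le.mpr hx.2))
    have key : ∀ ε : ℝ, (∀ x ∈ I ∩ Set.Iio z, 0 ≤ ε * f x * ∏ s ∈ S, (x - s)) →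
        (∀ x ∈ I ∩ Set.Ioi z, 0 < ε * f x) → ∀ x ∈ I, 0 ≤ ε * f x * ∏ s ∈ S, (x - s) := by
      intro ε h1 h2 x hx
      rcases lt_trichotomy x z with h | h | h
      · exact h1 x ⟨hx, h⟩
      · simp [h, hz0]
      · exact mul_nonneg (h2 x ⟨hx, h⟩).le (hpos x h).le
    have key2 : ∀ ε : ℝ, (∀ x ∈ I ∩ Set.Iio z, 0 ≤ -ε * f x * ∏ s ∈ S, (x - s)) →
        (∀ x ∈ I ∩ Set.Ioi z, 0 < ε * f x) →
        ∀ x ∈ I, 0 ≤ ε * f x * ∏ s ∈ insert z S, (x - s) := by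
      intro ε h1 h2 x hx
      rw [Finset.prod_insert hzS]
      rcases lt_trichotomy x z with h | h | h
      · have := h1 x ⟨hx, h⟩
        have h3 : 0 < z - x := sub_pos.mpr h
        nlinarith [mul_nonneg this h3.le]
      · simp [h]
      · exact mul_nonneg (h2 x ⟨hx, h⟩).le (mul_pos (sub_pos.mpr h) (hpos x h)).le
    rcases h with h | h <;> rcases hr with hr | hr
    · refine ⟨S, hsub, hS1, Or.inl ?_⟩
      simpa using key 1 (by simpa using h) (by simpa using hr)
    · refine ⟨insert z S, hsub2, hS2, Or.inr ?_⟩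
      simpa using key2 (-1) (by simpa using h) (by simpa using hr)
    · refine ⟨insert z S, hsub2, hS2, Or.inl ?_⟩
      simpa using key2 1 (by simpa using h) (by simpa using hr)
    · refine ⟨S, hsub, hS1, Or.inr ?_⟩
      simpa using key (-1) (by simpa using h) (by simpa using hr)

/-- A function with the sign of `± ∏ (x - s)`, a product of `m` factors, that is orthogonal to a
Chebyshev system of `m + 1` functions vanishes almost everywhere. -/
theorem IsTSystem.ae_eq_zero_of_orthogonal {m : ℕ} {I : Set ℝ} (hI : I.OrdConnected)
    {u : Fin (m + 1) → ℝ → ℝ} (hu : IsTSystem I u) {S : Finset ℝ} (hS : S.card = m) {f : ℝ → ℝ}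
    (hSf : ∀ s ∈ S, s ∈ I ∧ f s = 0)
    (hsgn : (∀ x ∈ I, 0 ≤ f x * ∏ s ∈ S, (x - s)) ∨ ∀ x ∈ I, 0 ≤ -f x * ∏ s ∈ S, (x - s))
    {ν : Measure ℝ} (hν : ν Iᶜ = 0) (hint : ∀ i, Integrable (fun x => f x * u i x) ν)
    (horth : ∀ i, ∫ x, f x * u i x ∂ν = 0) : ∀ᵐ x ∂ν, f x = 0 := by
  have hIae : ∀ᵐ x ∂ν, x ∈ I := hν
  suffices H : ∀ ε : ℝ, ε ≠ 0 → (∀ x ∈ I, 0 ≤ ε * f x * ∏ s ∈ S, (x - s)) → ∀ᵐ x ∂ν, f x = 0 by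
    rcases hsgn with h | h
    · exact H 1 one_ne_zero (by simpa using h)
    · exact H (-1) (by norm_num) (by simpa using h)
  intro ε hε h
  obtain ⟨a, ha⟩ := hu.exists_sign_changes hI hS fun s hs => (hSf s hs).1
  have hg : ∀ x, f x * ∑ i, a i * u i x = ∑ i, a i * (f x * u i x) := fun x => by
    rw [Finset.mul_sum]; exact Finset.sum_congr rfl fun i _ => by ring
  have hint1 : ∀ i ∈ Finset.univ, Integrable (fun x => a i * (f x * u i x)) ν := fun i _ =>
    (hint i).const_mul _
  have hint2 : Integrable (fun x => ε * (f x * ∑ i, a i * u i x)) ν := by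
    simp only [hg]
    exact (integrable_finsetSum _ hint1).const_mul _
  have h0 : ∫ x, ε * (f x * ∑ i, a i * u i x) ∂ν = 0 := by
    simp only [hg]
    rw [integral_const_mul, integral_finsetSum _ hint1]
    simp [integral_const_mul, horth]
  have hnn : 0 ≤ᵐ[ν] fun x => ε * (f x * ∑ i, a i * u i x) := by
    filter_upwards [hIae] with x hx
    by_cases hxS : x ∈ S
    · simp [(hSf x hxS).2]
    · have h1 := ha x hx hxS
      have h2 := h x hx
      have h3 := mul_nonneg h2 h1.le
      -- Both factors carry the sign of the same product, so their product is nonnegative after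
      -- division by its square.
      have h4 : 0 < (∏ s ∈ S, (x - s)) ^ 2 := by
        have : ∏ s ∈ S, (x - s) ≠ 0 := fun h => by simp [h] at h1
        positivity
      refine nonneg_of_mul_nonneg_left ?_ h4
      calc (0 : ℝ) ≤ _ := h3
        _ = _ := by ring
  have := (integral_eq_zero_iff_of_nonneg_ae hnn hint2).mp h0
  filter_upwards [this, hIae] with x hx hxI
  by_cases hxS : x ∈ S
  · exact (hSf x hxS).2
  · have h1 := ha x hxI hxS
    have h2 : ∑ i, a i * u i x ≠ 0 := fun h => by simp [h] at h1
    simpa [hε, h2] using hx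

/-! ### Zeros of exponential polynomials -/

/-- By Rolle a zero of `f'` lies between any two zeros of `f`, so `f` has at most one zero more. -/
theorem encard_zeros_lt_of_deriv {f f' : ℝ → ℝ} (hf : ∀ x, HasDerivAt f (f' x) x) {N : ℕ}
    (h : {x | f' x = 0}.encard < (N : ℕ∞)) : {x | f x = 0}.encard < ((N + 1 : ℕ) : ℕ∞) := by
  have hfin : {x | f' x = 0}.Finite := Set.finite_of_encard_le_coe h.le
  by_contra! hcon
  obtain ⟨s, hs, hs'⟩ := Set.exists_subset_encard_eq hcon
  have hsfin : s.Finite := Set.finite_of_encard_eq_coe hs'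
  have h1 : hsfin.toFinset.card ≤ hfin.toFinset.card + 1 := by
    refine Finset.card_le_of_interleaved fun x hx y hy hxy _ => ?_
    have hx0 : f x = 0 := hs (by simpa using hx)
    have hy0 : f y = 0 := hs (by simpa using hy)
    obtain ⟨z, hz, hz0⟩ := exists_hasDerivAt_eq_zero hxy
      (fun x _ => (hf x).continuousAt.continuousWithinAt) (hx0.trans hy0.symm) fun x _ => hf x
    exact ⟨z, by simpa using hz0, hz.1, hz.2⟩
  rw [hsfin.encard_eq_coe_toFinset_card] at hs'
  rw [hfin.encard_eq_coe_toFinset_card] at h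
  norm_cast at hs' h
  omega

theorem exists_eq_add_single {ι : Type*} [DecidableEq ι] {n : ι → ℕ} {j : ι} (h : 0 < n j) :
    ∃ n' : ι → ℕ, n = n' + Pi.single j 1 := by
  refine ⟨n - Pi.single j 1, funext fun i => ?_⟩
  rcases eq_or_ne i j with rfl | hij
  · simp; omega
  · simp [hij]

theorem sum_add_single {ι : Type*} [Fintype ι] [DecidableEq ι] (n : ι → ℕ) (j : ι) :
    ∑ i, (n + Pi.single j 1 : ι → ℕ) i = ∑ i, n i + 1 := by
  simp [Finset.sum_add_distrib]

/-- A nontrivial exponential polynomial with `N` coefficients has fewer than `N` real zeros. -/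
theorem encard_zeros_expPoly_lt {ι : Type*} [Fintype ι] : ∀ (N : ℕ) (c : ι → ℝ)
    (_hc : Function.Injective c) (n : ι → ℕ) (_hn : ∑ j, n j = N) (A : ι → ℝ[X])
    (_hA : ∀ j, (A j).degree < (n j : WithBot ℕ)) (_hA0 : A ≠ 0),
    {x : ℝ | ∑ j, (A j).eval x * Real.exp (c j * x) = 0}.encard < (N : ℕ∞) := by
  classical
  intro N
  induction N with
  | zero =>
    intro c hc n hn A hA hA0
    refine absurd (funext fun j => ?_) hA0
    have : n j = 0 := (Finset.sum_eq_zero_iff.mp hn) j (Finset.mem_univ j)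
    have := hA j
    simp_all [Nat.WithBot.lt_zero_iff]
  | succ N ih =>
    intro c hc n hn A hA hA0
    obtain ⟨j₀, hj₀⟩ : ∃ j, 0 < n j := by
      by_contra! h
      have : ∑ j, n j = 0 := Finset.sum_eq_zero fun j _ => by have := h j; omega
      omega
    obtain ⟨n', rfl⟩ := exists_eq_add_single hj₀
    rw [sum_add_single] at hn
    -- After division by `e ^ (c j₀ x)` the term `j₀` is a polynomial. Differentiation then lowers
    -- its degree bound by one and preserves the others, so the total number of coefficients drops
    -- by one.
    set B : ι → ℝ[X] := fun j => derivative (A j) + C (c j - c j₀) * A j with hB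
    have hBdeg : ∀ j, (B j).degree < (n' j : WithBot ℕ) := by
      intro j
      have h1 := (degree_lt_iff_coeff_zero _ _).mp (hA j)
      rw [degree_lt_iff_coeff_zero]
      intro m hm
      rcases eq_or_ne j j₀ with rfl | hj
      · simp only [hB, sub_self, C_0, zero_mul, add_zero, coeff_derivative]
        rw [h1 (m + 1) (by simpa using hm), zero_mul]
      · simp only [hB, coeff_add, coeff_derivative, coeff_C_mul]
        rw [h1 (m + 1) (by simp [hj]; omega), h1 m (by simpa [hj] using hm)]
        simp
    set f : ℝ → ℝ := fun x => ∑ j, (A j).eval x * Real.exp ((c j - c j₀) * x)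
    have hset : {x : ℝ | ∑ j, (A j).eval x * Real.exp (c j * x) = 0} = {x | f x = 0} := by
      ext x
      have : ∑ j, (A j).eval x * Real.exp (c j * x) = Real.exp (c j₀ * x) * f x := by
        rw [Finset.mul_sum]
        refine Finset.sum_congr rfl fun j _ => ?_
        rw [mul_left_comm, ← Real.exp_add]
        congr 2; ring
      simp [this]
    rw [hset]
    -- A vanishing derivative leaves a nonzero constant: for `j ≠ j₀` a nonzero `A j` would be
    -- proportional to its own derivative, against degrees.
    by_cases hB0 : B = 0
    · have hz : ∀ j, j ≠ j₀ → A j = 0 := by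
        intro j hj
        by_contra hAj
        have h1 : derivative (A j) = C (-(c j - c j₀)) * A j := by
          have h2 := congrFun hB0 j
          simp only [hB, Pi.zero_apply] at h2
          rw [C_neg]; linear_combination h2
        have h2 := degree_derivative_lt hAj
        rw [h1, degree_C_mul (by simpa [sub_eq_zero] using fun h => hj (hc h).symm)] at h2
        exact lt_irrefl _ h2
      have hd : derivative (A j₀) = 0 := by simpa [hB] using congrFun hB0 j₀
      have hA' := eq_C_of_derivative_eq_zero hd
      have ha : (A j₀).coeff 0 ≠ 0 := by
        intro h
        rw [h, C_0] at hA'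
        refine hA0 (funext fun j => ?_)
        rcases eq_or_ne j j₀ with rfl | hj
        exacts [hA', hz j hj]
      have hf : ∀ x, f x = (A j₀).coeff 0 := by
        intro x
        simp only [f]
        rw [Finset.sum_eq_single j₀ (fun j _ hj => by simp [hz j hj]) (by simp)]
        rw [hA']; simp
      simp [hf, ha]
    · have h1 := ih (fun j => c j - c j₀) (fun i j h => hc (by simpa using h)) n' (by omega)
        B hBdeg hB0
      refine encard_zeros_lt_of_deriv (fun x => ?_) h1
      refine HasDerivAt.fun_sum fun j _ => ?_
      have h2 := ((A j).hasDerivAt x).mul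
        (((hasDerivAt_id x).const_mul (c j - c j₀)).exp)
      refine h2.congr_deriv ?_
      simp [hB]
      ring

theorem encard_zeros_exp_sum_lt {ι : Type*} [Fintype ι] {c : ι → ℝ}
    (hc : Function.Injective c) {a : ι → ℝ} (ha : a ≠ 0) :
    {x : ℝ | ∑ j, a j * Real.exp (c j * x) = 0}.encard < (Fintype.card ι : ℕ∞) := by
  have := encard_zeros_expPoly_lt (Fintype.card ι) c hc (fun _ => 1) (by simp)
    (fun j => C (a j)) (fun j => lt_of_le_of_lt degree_C_le (by simp))
    (fun h => ha (funext fun j => by simpa using congrFun h j))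
  simpa using this

/-- Descartes' bound for generalized polynomials. -/
theorem encard_zeros_rpow_sum_lt {ι : Type*} [Fintype ι] {c : ι → ℝ}
    (hc : Function.Injective c) {a : ι → ℝ} (ha : a ≠ 0) :
    {x ∈ Set.Ioi (0 : ℝ) | ∑ j, a j * x ^ c j = 0}.encard < (Fintype.card ι : ℕ∞) := by
  have h := encard_zeros_exp_sum_lt hc ha
  rw [← Real.exp_injective.encard_image] at h
  refine lt_of_le_of_lt ?_ h
  refine Set.encard_le_encard fun x hx => ?_
  obtain ⟨hx0, hx⟩ := hx
  refine ⟨Real.log x, ?_, Real.exp_log hx0⟩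
  simp only [Set.mem_ofPred_eq]
  rw [← hx]
  refine Finset.sum_congr rfl fun j _ => ?_
  rw [Real.rpow_def_of_pos hx0, mul_comm (c j)]

theorem eval_mul_rpow_eq_sum {n : ℕ} {A : ℝ[X]} (hA : A.degree < (n : WithBot ℕ)) {x : ℝ}
    (hx : 0 < x) (α : ℝ) :
    A.eval x * x ^ α = ∑ i : Fin n, A.coeff i * x ^ (α + (i : ℕ)) := by
  have h : A.eval x = ∑ i ∈ Finset.range n, A.coeff i * x ^ i := by
    rcases eq_or_ne A 0 with rfl | h0
    · simp
    exact eval_eq_sum_range' ((natDegree_lt_iff_degree_lt h0).mpr hA) x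
  rw [h, Finset.sum_mul, ← Fin.sum_univ_eq_sum_range (fun i => A.coeff i * x ^ i * x ^ α)]
  refine Finset.sum_congr rfl fun i _ => ?_
  rw [Real.rpow_add hx, Real.rpow_natCast]
  ring

/-- Expanding the polynomials gives powers `x ^ (α j + i)`. The non-integrality of the differences
makes these exponents distinct, so the bound for generalized polynomials applies. -/
theorem encard_zeros_rpow_lt {r : ℕ} {α : Fin r → ℝ}
    (hα : ∀ i j, i ≠ j → ∀ z : ℤ, α i - α j ≠ (z : ℝ)) (n : Fin r → ℕ) {A : Fin r → ℝ[X]}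
    (hA : ∀ j, (A j).degree < (n j : WithBot ℕ)) (hA0 : A ≠ 0) :
    {x ∈ Set.Ioi (0 : ℝ) | ∑ j, (A j).eval x * x ^ α j = 0}.encard < ((∑ j, n j : ℕ) : ℕ∞) := by
  have hc : Function.Injective fun p : (Σ j : Fin r, Fin (n j)) => α p.1 + ((p.2 : ℕ) : ℝ) := by
    rintro ⟨i, k⟩ ⟨j, l⟩ h
    simp only at h
    by_cases hij : i = j
    · subst hij
      have : (k : ℕ) = l := by exact_mod_cast add_left_cancel h
      rw [Fin.ext this]
    · refine absurd ?_ (hα i j hij ((l : ℤ) - (k : ℤ)))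
      push_cast; linarith
  have ha : (fun p : (Σ j : Fin r, Fin (n j)) => (A p.1).coeff p.2) ≠ 0 := by
    intro h
    refine hA0 (funext fun j => Polynomial.ext fun i => ?_)
    by_cases hi : i < n j
    · simpa using congrFun h ⟨j, i, hi⟩
    · simpa using (degree_lt_iff_coeff_zero _ _).mp (hA j) i (not_lt.mp hi)
  have h := encard_zeros_rpow_sum_lt hc ha
  simp only [Fintype.card_sigma, Fintype.card_fin] at h
  convert h using 3
  ext x
  refine and_congr_right fun hx => ?_
  rw [Fintype.sum_sigma]
  simp only [eval_mul_rpow_eq_sum (hA _) hx]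

/-! ### AT systems of exponential and of power weights -/

/-- The constants `K j` accommodate normalizations outside the common measure, such as `(1 - p) ^ N`
for Krawtchouk; they are absorbed into the coefficient polynomials. -/
theorem isATSystem_exp {r : ℕ} {c K : Fin r → ℝ} (hc : Function.Injective c) (hK : ∀ j, 0 < K j)
    (ν : Measure ℝ) {μ : Fin r → Measure ℝ}
    (hμ : ∀ j, μ j = ν.withDensity fun x => ENNReal.ofReal (K j * Real.exp (c j * x))) :
    IsATSystem μ Set.univ := by
  refine ⟨Set.ordConnected_univ, ν, fun j x => K j * Real.exp (c j * x), by simp,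
    fun j => by fun_prop, fun j x _ => by have := hK j; positivity, hμ,
    fun n => ⟨fun j => by fun_prop, fun A hA hA0 => ?_⟩⟩
  have := encard_zeros_expPoly_lt _ c hc n rfl (fun j => C (K j) * A j)
    (fun j => by rw [degree_C_mul (hK j).ne']; exact hA j)
    (fun h => hA0 (funext fun j => by simpa [(hK j).ne'] using congrFun h j))
  convert this using 4 with x
  simp only [Set.mem_univ, true_and]
  refine Eq.congr (Finset.sum_congr rfl fun j _ => ?_) rfl
  simp
  ring

theorem isATSystem_rpow {r : ℕ} {α : Fin r → ℝ}
    (hα : ∀ i j, i ≠ j → ∀ z : ℤ, α i - α j ≠ (z : ℝ))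
    (ν : Measure ℝ) (hν : ν (Set.Ioi 0)ᶜ = 0) {μ : Fin r → Measure ℝ}
    (hμ : ∀ j, μ j = ν.withDensity fun x => ENNReal.ofReal (x ^ α j)) :
    IsATSystem μ (Set.Ioi 0) := by
  refine ⟨Set.ordConnected_Ioi, ν, fun j x => x ^ α j, hν, fun j => by fun_prop,
    fun j x hx => Real.rpow_nonneg (le_of_lt hx) _, hμ, fun n => ⟨fun j => ?_, fun A hA hA0 =>
    encard_zeros_rpow_lt hα n hA hA0⟩⟩
  exact fun x hx => (Real.continuousAt_rpow_const _ _ (Or.inl (ne_of_gt hx))).continuousWithinAt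

/-! ### Zeros of polynomials orthogonal to an AT system -/

/-- The sign-change argument needs a Chebyshev system of exactly `|S| + 1` functions; this supplies
the smaller multi-index. -/
theorem exists_le_sum_eq {ι : Type*} [Fintype ι] (n : ι → ℕ) :
    ∀ (d m : ℕ), ∑ j, n j = m + d → ∃ n' : ι → ℕ, n' ≤ n ∧ ∑ j, n' j = m := by
  classical
  intro d
  induction d with
  | zero => exact fun m h => ⟨n, le_rfl, h⟩
  | succ d ih =>
    intro m h
    obtain ⟨n₁, hn₁, hs⟩ := ih (m + 1) (by omega)
    obtain ⟨j, hj⟩ : ∃ j, 0 < n₁ j := by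
      by_contra! hcon
      have : ∑ j, n₁ j = 0 := Finset.sum_eq_zero fun j _ => by have := hcon j; omega
      omega
    obtain ⟨n₂, rfl⟩ := exists_eq_add_single hj
    rw [sum_add_single] at hs
    exact ⟨n₂, le_trans le_self_add hn₁, by omega⟩

variable {r : ℕ}

/-- Passes from coefficient polynomials to a flat list of functions, the form in which determinants
can be used. -/
theorem IsChebyshev.isTSystem {I : Set ℝ} {w : Fin r → ℝ → ℝ} {n : Fin r → ℕ}
    (h : IsChebyshev I w n) {N : ℕ} (hN : ∑ j, n j = N) (e : Fin N ≃ Σ j, Fin (n j)) :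
    IsTSystem I fun i x => x ^ ((e i).2 : ℕ) * w (e i).1 x := by
  refine ⟨fun i => ((continuous_pow _).continuousOn).mul (h.1 _), fun a ha => ?_⟩
  set A : Fin r → ℝ[X] := fun j => ∑ k : Fin (n j), C (a (e.symm ⟨j, k⟩)) * X ^ (k : ℕ)
  have hA0 : A ≠ 0 := by
    intro hA
    refine ha (funext fun i => ?_)
    have h1 := congrArg (fun p => coeff p ((e i).2 : ℕ)) (congrFun hA (e i).1)
    simp only [A, finsetSum_coeff, coeff_C_mul_X_pow, Pi.zero_apply, coeff_zero] at h1
    rw [Finset.sum_eq_single (e i).2] at h1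
    · simpa using h1
    · intro k _ hk
      rw [if_neg fun h => hk (Fin.ext h.symm)]
    · simp
  have := h.2 A (fun j => degree_sum_fin_lt _) hA0
  rw [hN] at this
  convert this using 4 with x
  refine and_congr_right fun _ => Eq.congr ?_ rfl
  rw [← Equiv.sum_comp e.symm, Fintype.sum_sigma]
  refine Finset.sum_congr rfl fun j _ => ?_
  simp only [A, eval_finsetSum, Finset.sum_mul]
  refine Finset.sum_congr rfl fun k _ => ?_
  simp only [eval_mul, eval_C, eval_pow, eval_X]
  rw [Equiv.apply_symm_apply]
  ring

/-- A polynomial orthogonal to an AT system with fewer than `|n|` sign changes vanishes almost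
everywhere. -/
theorem IsATSystem.ae_eq_zero {μ : Fin r → Measure ℝ} {I : Set ℝ} (h : IsATSystem μ I)
    (hint : ∀ j (q : ℝ[X]), Integrable (fun x => q.eval x) (μ j)) {n : Fin r → ℕ} {p : ℝ[X]}
    (horth : ∀ j, ∀ k < n j, ∫ x, x ^ k * p.eval x ∂(μ j) = 0) {S : Finset ℝ}
    (hS : ∀ s ∈ S, p.eval s = 0)
    (hsgn : (∀ x, 0 ≤ p.eval x * ∏ s ∈ S, (x - s)) ∨ ∀ x, 0 ≤ -p.eval x * ∏ s ∈ S, (x - s))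
    (hcard : S.card < ∑ j, n j) (j : Fin r) : ∀ᵐ x ∂μ j, p.eval x = 0 := by
  classical
  obtain ⟨hI, ν, w, hν, hwm, hw0, hμ, hch⟩ := h
  have hIae : ∀ᵐ x ∂ν, x ∈ I := hν
  -- Only sign changes inside `I` matter. The factors at points outside `I` have a constant sign on
  -- `I`, which is absorbed into the choice of sign.
  set S' := S.filter (· ∈ I)
  set g : ℝ → ℝ := fun x => ∏ s ∈ S.filter (· ∉ I), (x - s)
  have hprod : ∀ x, ∏ s ∈ S, (x - s) = (∏ s ∈ S', (x - s)) * g x := fun x =>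
    (Finset.prod_filter_mul_prod_filter_not S (· ∈ I) _).symm
  have hg : (∀ x ∈ I, 0 < g x) ∨ ∀ x ∈ I, g x < 0 := by
    refine pos_or_neg_of_ne_zero hI (by fun_prop) fun x hx h0 => ?_
    obtain ⟨s, hs, hs0⟩ := Finset.prod_eq_zero_iff.mp h0
    rw [sub_eq_zero] at hs0
    exact (Finset.mem_filter.mp hs).2 (hs0 ▸ hx)
  have hsgn' : (∀ x ∈ I, 0 ≤ p.eval x * ∏ s ∈ S', (x - s)) ∨
      ∀ x ∈ I, 0 ≤ -p.eval x * ∏ s ∈ S', (x - s) := by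
    simp only [hprod, ← mul_assoc] at hsgn
    rcases hsgn with h1 | h1 <;> rcases hg with h2 | h2
    · exact Or.inl fun x hx => nonneg_of_mul_nonneg_left (h1 x) (h2 x hx)
    · exact Or.inr fun x hx => by nlinarith [h1 x, h2 x hx]
    · exact Or.inr fun x hx => nonneg_of_mul_nonneg_left (h1 x) (h2 x hx)
    · exact Or.inl fun x hx => by nlinarith [h1 x, h2 x hx]
  have hcard' : S'.card + 1 ≤ ∑ j, n j :=
    lt_of_le_of_lt (Finset.card_filter_le _ _) hcard
  obtain ⟨n', hn', hsum⟩ := exists_le_sum_eq n (∑ j, n j - (S'.card + 1)) (S'.card + 1) (by omega)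
  obtain ⟨e⟩ : Nonempty (Fin (S'.card + 1) ≃ Σ j, Fin (n' j)) :=
    ⟨(Fintype.equivFinOfCardEq (by simp [hsum])).symm⟩
  have hT := (hch n').isTSystem hsum e
  have hconv : ∀ j (q : ℝ[X]), Integrable (fun x => q.eval x * w j x) ν ∧
      ∫ x, q.eval x ∂μ j = ∫ x, q.eval x * w j x ∂ν := by
    intro j q
    have hae : (fun x => (ENNReal.ofReal (w j x)).toReal • q.eval x) =ᵐ[ν]
        fun x => q.eval x * w j x := by
      filter_upwards [hIae] with x hx
      rw [ENNReal.toReal_ofReal (hw0 j x hx), smul_eq_mul, mul_comm]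
    have h1 := hint j q
    rw [hμ j, integrable_withDensity_iff_integrable_smul' (hwm j).ennreal_ofReal (by simp)] at h1
    refine ⟨h1.congr hae, ?_⟩
    rw [hμ j, integral_withDensity_eq_integral_toReal_smul (hwm j).ennreal_ofReal (by simp)]
    exact integral_congr_ae hae
  have hfun : ∀ i, (fun x => p.eval x * (x ^ ((e i).2 : ℕ) * w (e i).1 x)) =
      fun x => (X ^ ((e i).2 : ℕ) * p).eval x * w (e i).1 x := fun i => by
    ext x; simp; ring
  have hres : ∀ᵐ x ∂ν, p.eval x = 0 := by
    refine hT.ae_eq_zero_of_orthogonal hI (S := S') rfl (fun s hs => ?_) hsgn' hν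
      (fun i => ?_) fun i => ?_
    · exact ⟨(Finset.mem_filter.mp hs).2, hS s (Finset.mem_filter.mp hs).1⟩
    · simp only [hfun]; exact (hconv _ _).1
    · simp only [hfun]
      rw [← (hconv _ _).2]
      simpa using horth (e i).1 (e i).2 ((e i).2.isLt.trans_le (hn' _))
  rw [hμ j]
  exact (withDensity_absolutelyContinuous ν _).ae_le hres

theorem exists_polynomial_sign_set {p : ℝ[X]} (hp : p ≠ 0) :
    ∃ S ⊆ p.roots.toFinset, (∀ s ∈ S, p.eval s = 0) ∧
      ((∀ x, 0 ≤ p.eval x * ∏ s ∈ S, (x - s)) ∨ ∀ x, 0 ≤ -p.eval x * ∏ s ∈ S, (x - s)) := by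
  obtain ⟨S, h1, h2, h3⟩ := exists_sign_set (f := fun x => p.eval x) _ Set.ordConnected_univ
    p.continuous.continuousOn p.roots.toFinset (fun x _ hx => by simpa [hp] using hx) le_rfl
  exact ⟨S, h1, fun s hs => (h2 s hs).2, by simpa using h3⟩

theorem card_toFinset_roots_le (p : ℝ[X]) : p.roots.toFinset.card ≤ p.natDegree :=
  (Multiset.toFinset_card_le _).trans (card_roots' p)

/-- All zeros are real and simple. -/
def SimpleRealRoots (p : ℝ[X]) : Prop := p.roots.toFinset.card = p.natDegree

theorem SimpleRealRoots.derivative_ne_zero {p : ℝ[X]} (h : SimpleRealRoots p) (hp : p ≠ 0) {x : ℝ}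
    (hx : p.eval x = 0) : (derivative p).eval x ≠ 0 := by
  intro h0
  have h1 := (one_lt_rootMultiplicity_iff_isRoot hp).mpr ⟨hx, h0⟩
  have h2 : p.roots.toFinset.card = p.roots.card :=
    le_antisymm (Multiset.toFinset_card_le _) ((card_roots' p).trans h.ge)
  have h3 := Multiset.nodup_iff_count_le_one.mp (Multiset.toFinset_card_eq_card_iff_nodup.mp h2) x
  rw [count_roots] at h3
  omega

/-- A polynomial of degree at most `|S| + 1` that changes sign exactly at the points of `S`. -/
theorem simpleRealRoots_of_sign {p : ℝ[X]} (hp : p ≠ 0) {S : Finset ℝ}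
    (hS : S ⊆ p.roots.toFinset)
    (hsgn : (∀ x, 0 ≤ p.eval x * ∏ s ∈ S, (x - s)) ∨ ∀ x, 0 ≤ -p.eval x * ∏ s ∈ S, (x - s))
    (hdeg : p.natDegree ≤ S.card + 1) : SimpleRealRoots p := by
  unfold SimpleRealRoots
  have h1 := card_toFinset_roots_le p
  have h2 := Finset.card_le_card hS
  -- The only failing case has degree `|S| + 1` and no roots outside `S`. The cofactor of `∏ (X -
  -- s)` is then linear and would need a constant sign.
  by_contra hne
  have hdeg' : p.natDegree = S.card + 1 := by omega
  have hle : S.val ≤ p.roots :=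
    (Finset.val_le_iff.mpr hS).trans (Multiset.dedup_le _)
  obtain ⟨q, hq⟩ := (Multiset.prod_X_sub_C_dvd_iff_le_roots hp _).mpr hle
  have hmonic : (S.val.map fun a => X - C a).prod.Monic := monic_multiset_prod_of_monic _ _
    fun a _ => monic_X_sub_C a
  have hq0 : q ≠ 0 := by rintro rfl; simp at hq; exact hp hq
  have hqd : q.natDegree = 1 := by
    have := hmonic.natDegree_mul' hq0
    rw [← hq, natDegree_multiset_prod_X_sub_C_eq_card, hdeg', Finset.card_val] at this
    omega
  have heval : ∀ x, p.eval x = (∏ s ∈ S, (x - s)) * q.eval x := by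
    intro x
    rw [hq, eval_mul, eval_multiset_prod, Multiset.map_map]
    simp [Finset.prod_map_val]
  obtain ⟨a, ha, b, rfl⟩ : ∃ a ≠ 0, ∃ b, q = C a * X + C b :=
    natDegree_eq_one.mp hqd |>.imp fun a h => ⟨h.1, h.2.imp fun b hb => hb.symm⟩
  suffices H : ∀ ε : ℝ, ε ≠ 0 → ¬ ∀ x, 0 ≤ ε * p.eval x * ∏ s ∈ S, (x - s) by
    rcases hsgn with h | h
    · exact H 1 one_ne_zero (by simpa using h)
    · exact H (-1) (by norm_num) (by simpa using h)
  intro ε hε h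
  -- The inequality holds off `S` and is a closed condition; the complement of the finite set `S` is
  -- dense.
  have hcl : ∀ x, 0 ≤ ε * (a * x + b) := by
    have hd : Dense ((S : Set ℝ)ᶜ) := S.countable_toSet.dense_compl ℝ
    have hclosed : IsClosed {x : ℝ | 0 ≤ ε * (a * x + b)} :=
      isClosed_le continuous_const (by fun_prop)
    intro x
    refine hclosed.closure_subset_iff.mpr (fun y hy => ?_) (hd x)
    have h3 := h y
    rw [heval] at h3
    have h4 : 0 < (∏ s ∈ S, (y - s)) ^ 2 := by
      have : ∏ s ∈ S, (y - s) ≠ 0 := Finset.prod_ne_zero_iff.mpr fun s hs h =>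
        hy (by rw [sub_eq_zero] at h; simpa [h] using hs)
      positivity
    refine nonneg_of_mul_nonneg_left ?_ h4
    refine h3.trans_eq ?_
    simp
    ring
  have h5 := hcl ((-b - ε * a) / a)
  rw [mul_div_cancel₀ _ ha] at h5
  have h6 : 0 < ε ^ 2 := by positivity
  -- At this point the linear factor equals `-ε`, so the product is `-ε²`.
  have h7 := hcl ((-b - ε) / a)
  rw [mul_div_cancel₀ _ ha] at h7
  nlinarith

variable {μ : Fin r → Measure ℝ} {I : Set ℝ}

/-- With at least `|n|` sign changes and degree at most `|n| + 1` there is no room for a nonreal or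
multiple zero. With fewer, `p` vanishes almost everywhere and `hsupp` provides as many distinct
zeros as the degree permits. The number `D` keeps finite supports in view: it is `N` for Krawtchouk,
while for infinite supports it may be taken to be `|n|`. -/
theorem IsATSystem.simpleRealRoots (h : IsATSystem μ I)
    (hint : ∀ j (q : ℝ[X]), Integrable (fun x => q.eval x) (μ j)) {D : ℕ}
    (hsupp : ∀ j (p : ℝ[X]), p ≠ 0 → (∀ᵐ x ∂μ j, p.eval x = 0) →
      D + 1 ≤ p.roots.toFinset.card) {n : Fin r → ℕ} (hn : ∑ j, n j ≤ D)
    {p : ℝ[X]} (hp : p ≠ 0) (hdeg : p.natDegree ≤ ∑ j, n j + 1)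
    (horth : ∀ j, ∀ k < n j, ∫ x, x ^ k * p.eval x ∂(μ j) = 0) : SimpleRealRoots p := by
  obtain ⟨S, h1, h2, h3⟩ := exists_polynomial_sign_set hp
  rcases lt_or_ge S.card (∑ j, n j) with hlt | hge
  · obtain ⟨j, -, -⟩ : ∃ j ∈ Finset.univ, n j ≠ 0 :=
      Finset.exists_ne_zero_of_sum_ne_zero (by omega)
    have := hsupp j p hp (h.ae_eq_zero hint horth h2 h3 hlt j)
    exact le_antisymm (card_toFinset_roots_le p) (by omega)
  · exact simpleRealRoots_of_sign hp h1 h3 (by omega)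

/-- A degree below `|n|` leaves too few sign changes, so a nonzero `p` would vanish almost
everywhere and have `D + 1 ≥ |n|` zeros. This permits one unit more in `|n|` than the argument for
simple zeros. -/
theorem IsATSystem.eq_zero_of_orthogonal (h : IsATSystem μ I)
    (hint : ∀ j (q : ℝ[X]), Integrable (fun x => q.eval x) (μ j)) {D : ℕ}
    (hsupp : ∀ j (p : ℝ[X]), p ≠ 0 → (∀ᵐ x ∂μ j, p.eval x = 0) →
      D + 1 ≤ p.roots.toFinset.card) {n : Fin r → ℕ} (hn : ∑ j, n j ≤ D + 1)
    {p : ℝ[X]} (hdeg : p.degree < ((∑ j, n j : ℕ) : WithBot ℕ))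
    (horth : ∀ j, ∀ k < n j, ∫ x, x ^ k * p.eval x ∂(μ j) = 0) : p = 0 := by
  by_contra hp
  rw [← natDegree_lt_iff_degree_lt hp] at hdeg
  obtain ⟨S, h1, h2, h3⟩ := exists_polynomial_sign_set hp
  have h4 := Finset.card_le_card h1
  have h5 := card_toFinset_roots_le p
  obtain ⟨j, -, -⟩ : ∃ j ∈ Finset.univ, n j ≠ 0 :=
    Finset.exists_ne_zero_of_sum_ne_zero (by omega)
  have := hsupp j p hp (h.ae_eq_zero hint horth h2 h3 (by omega) j)
  omega

/-! ### Normality -/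

theorem integrable_pow_mul {μ : Measure ℝ} (hint : ∀ q : ℝ[X], Integrable (fun x => q.eval x) μ)
    (k : ℕ) (p : ℝ[X]) : Integrable (fun x : ℝ => x ^ k * p.eval x) μ := by
  have h := hint (X ^ k * p)
  simp only [eval_mul, eval_pow, eval_X] at h
  exact h

/-- The orthogonality conditions are `|n|` linear functionals on the `|n|`-dimensional space of
polynomials of degree below `|n|`. Injectivity gives surjectivity, so some `q` cancels the moments
of `X ^ |n|`; the difference of two monic solutions falls back into that space. -/
theorem isNormal_of_eq_zero
    (hint : ∀ j (q : ℝ[X]), Integrable (fun x => q.eval x) (μ j)) {n : Fin r → ℕ}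
    (hz : ∀ p : ℝ[X], p.degree < ((∑ j, n j : ℕ) : WithBot ℕ) →
      (∀ j, ∀ k < n j, ∫ x, x ^ k * p.eval x ∂(μ j) = 0) → p = 0) : IsNormal μ n := by
  have hi := fun j k p => integrable_pow_mul (hint j) k p
  set N := ∑ j, n j with hN
  let L : degreeLT ℝ N →ₗ[ℝ] ((Σ j, Fin (n j)) → ℝ) :=
    { toFun := fun p i => ∫ x, x ^ (i.2 : ℕ) * (p : ℝ[X]).eval x ∂(μ i.1)
      map_add' := fun p q => by
        ext i
        simp only [Submodule.coe_add, eval_add, mul_add, Pi.add_apply]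
        exact integral_add (hi _ _ _) (hi _ _ _)
      map_smul' := fun c p => by
        ext i
        simp only [Submodule.coe_smul, eval_smul, smul_eq_mul, Pi.smul_apply, RingHom.id_apply]
        rw [← integral_const_mul]
        congr 1; ext x; ring }
  have hinj : Function.Injective L := by
    rw [← LinearMap.ker_eq_bot, LinearMap.ker_eq_bot']
    intro p hp
    refine Subtype.ext (hz p (mem_degreeLT.mp p.2) fun j k hk => ?_)
    exact congrFun hp ⟨j, k, hk⟩
  have hfin : FiniteDimensional ℝ (degreeLT ℝ N) :=
    LinearEquiv.finiteDimensional (degreeLTEquiv ℝ N).symm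
  have hrank : Module.finrank ℝ (degreeLT ℝ N) = Module.finrank ℝ ((Σ j, Fin (n j)) → ℝ) := by
    rw [(degreeLTEquiv ℝ N).finrank_eq]
    simp [hN]
  obtain ⟨q, hq⟩ := (LinearMap.injective_iff_surjective_of_finrank_eq_finrank hrank).mp hinj
    fun i => -∫ x, x ^ (i.2 : ℕ) * (X ^ N : ℝ[X]).eval x ∂(μ i.1)
  have hqd : (q : ℝ[X]).degree < (X ^ N : ℝ[X]).degree := by
    rw [degree_X_pow]; exact mem_degreeLT.mp q.2
  have hmonic : (X ^ N + (q : ℝ[X])).Monic := (monic_X_pow N).add_of_left hqd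
  have horth : ∀ j, ∀ k < n j, ∫ x, x ^ k * (X ^ N + (q : ℝ[X])).eval x ∂(μ j) = 0 := by
    intro j k hk
    have := congrFun hq ⟨j, k, hk⟩
    simp only [L, LinearMap.coe_mk, AddHom.coe_mk] at this
    simp only [eval_add, mul_add]
    rw [integral_add (hi _ _ _) (hi _ _ _), this]
    ring
  refine ⟨X ^ N + (q : ℝ[X]), ⟨hmonic, ?_, fun j k hk => ⟨hi _ _ _, horth j k hk⟩⟩, ?_⟩
  · rw [natDegree_add_eq_left_of_degree_lt hqd, natDegree_X_pow]
  · rintro P ⟨hP1, hP2, hP3⟩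
    rw [← sub_eq_zero]
    refine hz _ ?_ fun j k hk => ?_
    · have h5 : (X ^ N + (q : ℝ[X])).degree = (N : WithBot ℕ) := by
        rw [degree_add_eq_left_of_degree_lt hqd, degree_X_pow]
      have h6 : P.degree = (N : WithBot ℕ) := by rw [degree_eq_natDegree hP1.ne_zero, hP2]
      rw [← h6]
      exact degree_sub_lt_left (h6.trans h5.symm) hP1.ne_zero (by rw [hP1, hmonic])
    · simp only [eval_sub, mul_sub]
      rw [integral_sub (hi _ _ _) (hi _ _ _), horth j k hk, (hP3 j k hk).2, sub_zero]

theorem IsNormal.poly_spec {n : Fin r → ℕ} (h : IsNormal μ n) : IsTypeII μ n (poly μ n) := by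
  rw [poly, dif_pos h]
  exact h.choose_spec.1

theorem IsNormal.eq_poly {n : Fin r → ℕ} (h : IsNormal μ n) {P : ℝ[X]} (hP : IsTypeII μ n P) :
    P = poly μ n := h.unique hP h.poly_spec

/-! ### Interlacing -/

/-- If `P` had no zero on `[a, b]`, Rolle for `Q / P` would produce a zero of the Wronskian; a
common zero at an endpoint is one already. -/
theorem exists_root_between {P Q : ℝ[X]}
    (hW : ∀ x, P.eval x * (derivative Q).eval x - (derivative P).eval x * Q.eval x ≠ 0)
    {a b : ℝ} (hab : a < b) (ha : Q.eval a = 0) (hb : Q.eval b = 0) :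
    ∃ x, a < x ∧ x < b ∧ P.eval x = 0 := by
  by_contra! hcon
  have hP : ∀ x ∈ Set.Icc a b, P.eval x ≠ 0 := by
    rintro x ⟨hxa, hxb⟩
    rcases hxa.eq_or_lt with rfl | hxa
    · intro h; exact hW a (by simp [h, ha])
    rcases hxb.eq_or_lt with rfl | hxb
    · intro h; exact hW x (by simp [h, hb])
    exact hcon x hxa hxb
  obtain ⟨x, hx, h0⟩ := exists_hasDerivAt_eq_zero (f := fun x => Q.eval x / P.eval x) hab
    (Q.continuous.continuousOn.div P.continuous.continuousOn hP) (by simp [ha, hb])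
    (fun x hx => (Q.hasDerivAt x).div (P.hasDerivAt x) (hP x (Set.Ioo_subset_Icc_self hx)))
  have h1 := hP x (Set.Ioo_subset_Icc_self hx)
  rw [div_eq_zero_iff] at h0
  rcases h0 with h0 | h0
  · exact hW x (by linear_combination h0)
  · exact h1 (by simpa using h0)

/-- A zero of the Wronskian at `x` would make some combination vanish doubly at `x`. Hence each of
the `m` gaps between zeros of `Q` contains a zero of `P`, and the degree of `P` allows no others. -/
theorem interlace_of_pencil {P Q : ℝ[X]} {m : ℕ} (hP : P.natDegree = m) (hP0 : P ≠ 0)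
    (hQ : Q.natDegree = m + 1)
    (hpen : ∀ a b : ℝ, (a ≠ 0 ∨ b ≠ 0) → SimpleRealRoots (C a * P + C b * Q)) :
    Interlace P Q := by
  have hQ0 : Q ≠ 0 := by rintro rfl; simp at hQ
  have hne : ∀ a b : ℝ, (a ≠ 0 ∨ b ≠ 0) → C a * P + C b * Q ≠ 0 := by
    intro a b hab h0
    by_cases hb : b = 0
    · subst hb; simp [hP0] at h0; simp [h0] at hab
    · have h1 : C b * Q = -(C a * P) := by linear_combination h0
      have h2 := congrArg natDegree h1
      rw [natDegree_C_mul hb, natDegree_neg, hQ] at h2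
      have := natDegree_C_mul_le a P
      omega
  have hW : ∀ x, P.eval x * (derivative Q).eval x - (derivative P).eval x * Q.eval x ≠ 0 := by
    intro x h0
    have key : ∀ a b : ℝ, (a ≠ 0 ∨ b ≠ 0) → a * P.eval x + b * Q.eval x = 0 →
        a * (derivative P).eval x + b * (derivative Q).eval x ≠ 0 := by
      intro a b hab h1 h2
      refine (hpen a b hab).derivative_ne_zero (hne a b hab) (x := x) (by simpa using h1) ?_
      simpa using h2
    -- The combination `Q(x) P - P(x) Q` vanishes at `x`, and its derivative there is minus the
    -- Wronskian. It is trivial when both values are zero; the derivatives at `x` then serve as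
    -- coefficients.
    by_cases h1 : Q.eval x = 0 ∧ P.eval x = 0
    · by_cases h2 : (derivative Q).eval x = 0
      · exact key 0 1 (by simp) (by simp [h1.1]) (by simp [h2])
      · exact key ((derivative Q).eval x) (-(derivative P).eval x) (Or.inl h2)
          (by simp [h1.1, h1.2]) (by ring)
    · refine key (Q.eval x) (-P.eval x) ?_ (by ring) (by linear_combination -h0)
      by_contra! h; exact h1 ⟨h.1, by simpa using h.2⟩
  have hPs : P.roots.toFinset.card = m := by
    have := hpen 1 0 (by simp)
    simpa [SimpleRealRoots, hP] using this
  have hQs : Q.roots.toFinset.card = m + 1 := by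
    have := hpen 0 1 (by simp)
    simpa [SimpleRealRoots, hQ] using this
  set y := Q.roots.toFinset.orderEmbOfFin hQs
  have hyroot : ∀ i, Q.eval (y i) = 0 := fun i => by
    have := Finset.orderEmbOfFin_mem _ hQs i
    rwa [Multiset.mem_toFinset, mem_roots hQ0] at this
  have hex : ∀ i : Fin m, ∃ x, y i.castSucc < x ∧ x < y i.succ ∧ P.eval x = 0 := fun i =>
    exists_root_between hW (y.strictMono Fin.castSucc_lt_succ) (hyroot _) (hyroot _)
  choose x hx1 hx2 hx3 using hex
  have hxm : StrictMono x := by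
    intro i j hij
    refine (hx2 i).trans (lt_of_le_of_lt (y.monotone ?_) (hx1 j))
    rw [Fin.le_iff_val_le_val]; simpa using hij
  have eq_of : ∀ {R : ℝ[X]} {d : ℕ} (_ : R ≠ 0) (_ : R.natDegree = d)
      (_ : R.roots.toFinset.card = d) {z : Fin d → ℝ} (_ : Function.Injective z)
      (_ : ∀ i, R.eval (z i) = 0), R.roots = Finset.univ.val.map z := by
    intro R d hR0 hRd hRs z hz hz0
    have h1 : Finset.univ.val.map z ≤ R.roots := by
      rw [Multiset.le_iff_subset (Finset.univ.nodup.map hz)]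
      intro t ht
      obtain ⟨i, -, rfl⟩ := Multiset.mem_map.mp ht
      simpa [hR0] using hz0 i
    refine (Multiset.eq_of_le_of_card_le h1 ?_).symm
    simpa [← hRd] using card_roots' R
  exact ⟨m, x, y, hP0, hP, hQ, eq_of hP0 hP hPs hxm.injective hx3,
    eq_of hQ0 hQ hQs y.injective hyroot, fun i => ⟨hx1 i, hx2 i⟩⟩

/-- Normality and interlacing for an AT system whose measures have more than `D` points of
increase. -/
theorem IsATSystem.isNormal_and_interlace (h : IsATSystem μ I)
    (hint : ∀ j (q : ℝ[X]), Integrable (fun x => q.eval x) (μ j)) {D : ℕ}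
    (hsupp : ∀ j (p : ℝ[X]), p ≠ 0 → (∀ᵐ x ∂μ j, p.eval x = 0) →
      D + 1 ≤ p.roots.toFinset.card) :
    (∀ n : Fin r → ℕ, ∑ j, n j ≤ D + 1 → IsNormal μ n) ∧
    ∀ n : Fin r → ℕ, ∑ j, n j ≤ D → ∀ k, Interlace (poly μ n) (upperPoly μ n k) := by
  have hnorm : ∀ n : Fin r → ℕ, ∑ j, n j ≤ D + 1 → IsNormal μ n := fun n hn =>
    isNormal_of_eq_zero hint fun p hp horth => h.eq_zero_of_orthogonal hint hsupp hn hp horth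
  refine ⟨hnorm, fun n hn k => ?_⟩
  have hs := sum_add_single n k
  obtain ⟨hP1, hP2, hP3⟩ := (hnorm n (by omega)).poly_spec
  obtain ⟨hQ1, hQ2, hQ3⟩ := (hnorm (n + Pi.single k 1) (by omega)).poly_spec
  rw [hs] at hQ2
  refine interlace_of_pencil hP2 hP1.ne_zero hQ2 fun a b hab => ?_
  by_cases h0 : C a * poly μ n + C b * upperPoly μ n k = 0
  · simp [h0, SimpleRealRoots]
  refine h.simpleRealRoots hint hsupp hn h0 ?_ fun j i hi => ?_
  · refine (natDegree_add_le _ _).trans (max_le ?_ ?_)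
    · exact (natDegree_C_mul_le _ _).trans (by omega)
    · exact (natDegree_C_mul_le _ _).trans hQ2.le
  · have e : (fun x : ℝ => x ^ i * (C a * poly μ n + C b * upperPoly μ n k).eval x) =
        fun x => a * (x ^ i * (poly μ n).eval x) + b * (x ^ i * (upperPoly μ n k).eval x) := by
      ext x; simp; ring
    have h1 := hP3 j i hi
    have h2 : Integrable (fun x => x ^ i * (upperPoly μ n k).eval x) (μ j) ∧
      ∫ x, x ^ i * (upperPoly μ n k).eval x ∂(μ j) = 0 := hQ3 j i (hi.trans_le (by simp))
    rw [e, integral_add (h1.1.const_mul _) (h2.1.const_mul _), integral_const_mul,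
      integral_const_mul, h1.2, h2.2]
    simp

/-! ### Nearest neighbour recurrences through the moment transform -/

noncomputable section

/-- The operator `q ↦ l X q + (s₂ X² + s₁ X + s₀) q'`, the image of multiplication by `x` under the
moment transform. -/
def raisingOp (l s₂ s₁ s₀ : ℝ) : Module.End ℝ ℝ[X] :=
  LinearMap.mulLeft ℝ (C l * X) +
    (LinearMap.mulLeft ℝ (C s₂ * X ^ 2 + C s₁ * X + C s₀)).comp derivative

/-- The moment transform: the linear map with `1 ↦ 1` that turns multiplication by `X` into
`raisingOp`. -/
def momentTransform (l s₂ s₁ s₀ : ℝ) : ℝ[X] →ₗ[ℝ] ℝ[X] :=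
  (LinearMap.applyₗ (1 : ℝ[X])).comp (aeval (raisingOp l s₂ s₁ s₀)).toLinearMap

/-- Leading coefficients of the moment transforms of monic polynomials. -/
def transformCoeff (l s₂ : ℝ) (m : ℕ) : ℝ := ∏ i ∈ Finset.range m, (l + s₂ * i)

variable {l s₂ s₁ s₀ : ℝ}

theorem transformCoeff_succ (l s₂ : ℝ) (m : ℕ) :
    transformCoeff l s₂ (m + 1) = transformCoeff l s₂ m * (l + s₂ * m) :=
  Finset.prod_range_succ _ _

theorem raisingOp_apply (q : ℝ[X]) : raisingOp l s₂ s₁ s₀ q =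
    C l * X * q + (C s₂ * X ^ 2 + C s₁ * X + C s₀) * derivative q := by
  simp [raisingOp, mul_assoc]

theorem momentTransform_one : momentTransform l s₂ s₁ s₀ 1 = 1 := by
  simp [momentTransform]

theorem momentTransform_X_mul (p : ℝ[X]) : momentTransform l s₂ s₁ s₀ (X * p) =
    raisingOp l s₂ s₁ s₀ (momentTransform l s₂ s₁ s₀ p) := by
  simp [momentTransform]

theorem momentTransform_C_mul (c : ℝ) (p : ℝ[X]) : momentTransform l s₂ s₁ s₀ (C c * p) =
    C c * momentTransform l s₂ s₁ s₀ p := by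
  rw [← smul_eq_C_mul, map_smul, smul_eq_C_mul]

/-- The raising operator is of first order, so each multiplication by `X` costs at most one order of
vanishing at `z`. -/
theorem eval_momentTransform_eq_zero {z : ℝ} : ∀ (k : ℕ) {p : ℝ[X]},
    (X - C z) ^ (k + 1) ∣ momentTransform l s₂ s₁ s₀ p →
    (momentTransform l s₂ s₁ s₀ (X ^ k * p)).eval z = 0 := by
  intro k
  induction k with
  | zero =>
    intro p hp
    simpa [dvd_iff_isRoot] using hp
  | succ k ih =>
    intro p hp
    rw [pow_succ, mul_assoc]
    refine ih ?_
    rw [momentTransform_X_mul, raisingOp_apply]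
    refine dvd_add (Dvd.dvd.mul_left ((pow_dvd_pow _ (by omega)).trans hp) _) (Dvd.dvd.mul_left ?_ _)
    simpa using pow_sub_one_dvd_derivative_of_pow_dvd hp

/-- `∏ (X - z_j) ^ n_j`. -/
def nodePoly (z : Fin r → ℝ) (n : Fin r → ℕ) : ℝ[X] := ∏ j, (X - C (z j)) ^ n j

/-- `∏ (X - z_i) ^ (n - e_j)_i`, which is `0` by convention when `n_j = 0`. -/
def lowerNodePoly (z : Fin r → ℝ) (n : Fin r → ℕ) (j : Fin r) : ℝ[X] :=
  if n j = 0 then 0 else nodePoly z (n - Pi.single j 1)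

theorem nodePoly_add_single (z : Fin r → ℝ) (n : Fin r → ℕ) (k : Fin r) :
    nodePoly z (n + Pi.single k 1) = (X - C (z k)) * nodePoly z n := by
  simp only [nodePoly, Pi.add_apply, pow_add, Finset.prod_mul_distrib]
  rw [Finset.prod_eq_single k (f := fun j => (X - C (z j)) ^ (Pi.single k 1 : Fin r → ℕ) j)]
  · simp [mul_comm]
  · intro j _ hj; simp [hj]
  · simp

/-- The factor `n j` lets the identity cover `n j = 0`, where `lowerNodePoly` is zero by convention.
-/
theorem mul_lowerNodePoly (z : Fin r → ℝ) (n : Fin r → ℕ) (j : Fin r) :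
    C (n j : ℝ) * ((X - C (z j)) * lowerNodePoly z n j) = C (n j : ℝ) * nodePoly z n := by
  rcases Nat.eq_zero_or_pos (n j) with h | h
  · simp [h]
  · obtain ⟨n', rfl⟩ := exists_eq_add_single h
    rw [lowerNodePoly, if_neg h.ne', add_tsub_cancel_right, nodePoly_add_single]

theorem derivative_nodePoly (z : Fin r → ℝ) (n : Fin r → ℕ) :
    derivative (nodePoly z n) = ∑ j, C (n j : ℝ) * lowerNodePoly z n j := by
  rw [nodePoly, derivative_prod_finset]
  refine Finset.sum_congr rfl fun j _ => ?_
  rcases Nat.eq_zero_or_pos (n j) with h | h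
  · simp [h]
  · rw [lowerNodePoly, if_neg h.ne', nodePoly, ← Finset.mul_prod_erase _ _ (Finset.mem_univ j),
      derivative_X_sub_C_pow]
    simp only [Pi.sub_apply, Pi.single_eq_same]
    have : ∏ x ∈ Finset.univ.erase j, (X - C (z x)) ^ (n x - (Pi.single j 1 : Fin r → ℕ) x) =
        ∏ x ∈ Finset.univ.erase j, (X - C (z x)) ^ n x :=
      Finset.prod_congr rfl fun x hx => by simp [(Finset.mem_erase.mp hx).1]
    rw [this]
    ring

/-- This is the recurrence after the transform. At each node, `s₂ X² + s₁ X + s₀` equals `(X - z_j)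
(s₂ (X + z_j) + s₁)` plus its value at `z_j`; the first part restores the full node polynomial, the
second yields the lower neighbour. Writing the remaining `X` as `(X - z_k) + z_k` yields the upper
one. -/
theorem raisingOp_nodePoly (z : Fin r → ℝ) (n : Fin r → ℕ) (k : Fin r) :
    raisingOp l s₂ s₁ s₀ (nodePoly z n) =
      C (l + s₂ * ∑ j, (n j : ℝ)) * nodePoly z (n + Pi.single k 1) +
      C ((l + s₂ * ∑ j, (n j : ℝ)) * z k + ∑ j, (n j : ℝ) * (s₂ * z j + s₁)) * nodePoly z n +
      ∑ j, C ((n j : ℝ) * (s₂ * z j ^ 2 + s₁ * z j + s₀)) * lowerNodePoly z n j := by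
  have h1 : ∀ j, (C s₂ * X ^ 2 + C s₁ * X + C s₀) * (C (n j : ℝ) * lowerNodePoly z n j) =
      (C s₂ * X) * C (n j : ℝ) * nodePoly z n + C ((n j : ℝ) * (s₂ * z j + s₁)) * nodePoly z n +
      C ((n j : ℝ) * (s₂ * z j ^ 2 + s₁ * z j + s₀)) * lowerNodePoly z n j := by
    intro j
    simp only [map_add, map_mul, map_pow]
    linear_combination (C s₂ * (X + C (z j)) + C s₁) * mul_lowerNodePoly z n j
  rw [raisingOp_apply, derivative_nodePoly, Finset.mul_sum, Finset.sum_congr rfl fun j _ => h1 j,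
    Finset.sum_add_distrib, Finset.sum_add_distrib, ← Finset.sum_mul, ← Finset.sum_mul,
    ← Finset.mul_sum, nodePoly_add_single, ← map_sum, ← map_sum]
  simp only [map_add, map_mul]
  ring

/-- `P` is monic of degree `|n|` and its moment transform is proportional to `nodePoly z n`. -/
def HasTransform (l s₂ s₁ s₀ : ℝ) (z : Fin r → ℝ) (n : Fin r → ℕ) (P : ℝ[X]) : Prop :=
  P.Monic ∧ P.natDegree = ∑ j, n j ∧
    momentTransform l s₂ s₁ s₀ P = C (transformCoeff l s₂ (∑ j, n j)) * nodePoly z n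

/-- The factor `l + s₂ (|n| - 1)` is the step from `transformCoeff` at `|n| - 1` to that at `|n|`.
The neighbours `L` are left arbitrary, so that the same step both constructs the polynomials and
identifies the recurrence. -/
theorem HasTransform.add_single {z : Fin r → ℝ} {n : Fin r → ℕ} {P : ℝ[X]}
    (hP : HasTransform l s₂ s₁ s₀ z n P) {L : Fin r → ℝ[X]} (hL0 : ∀ j, n j = 0 → L j = 0)
    (hL : ∀ j, n j ≠ 0 → HasTransform l s₂ s₁ s₀ z (n - Pi.single j 1) (L j)) (k : Fin r) :
    HasTransform l s₂ s₁ s₀ z (n + Pi.single k 1) (X * P -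
      C ((l + s₂ * ∑ j, (n j : ℝ)) * z k + ∑ j, (n j : ℝ) * (s₂ * z j + s₁)) * P -
      ∑ j, C ((n j : ℝ) * (s₂ * z j ^ 2 + s₁ * z j + s₀) * (l + s₂ * (∑ j, (n j : ℝ) - 1))) *
        L j) := by
  obtain ⟨hP1, hP2, hP3⟩ := hP
  have hsum : ∀ j, n j ≠ 0 → ∑ i, n i = ∑ i, (n - Pi.single j 1 : Fin r → ℕ) i + 1 := by
    intro j hj
    obtain ⟨n', rfl⟩ := exists_eq_add_single (Nat.pos_of_ne_zero hj)
    rw [add_tsub_cancel_right, sum_add_single]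
  have hX : (X * P).natDegree = ∑ j, n j + 1 := by
    rw [natDegree_X_mul hP1.ne_zero, hP2]
  set R := C ((l + s₂ * ∑ j, (n j : ℝ)) * z k + ∑ j, (n j : ℝ) * (s₂ * z j + s₁)) * P +
      ∑ j, C ((n j : ℝ) * (s₂ * z j ^ 2 + s₁ * z j + s₀) * (l + s₂ * (∑ j, (n j : ℝ) - 1))) * L j
    with hR
  have hRnat : R.natDegree ≤ ∑ j, n j := by
    refine (natDegree_add_le _ _).trans (max_le ((natDegree_C_mul_le _ _).trans hP2.le) ?_)
    refine natDegree_sum_le_of_forall_le _ _ fun j _ => (natDegree_C_mul_le _ _).trans ?_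
    by_cases hj : n j = 0
    · simp [hL0 j hj]
    · rw [(hL j hj).2.1, hsum j hj]; omega
  have hRdeg : R.degree < (X * P).degree := degree_lt_degree (by omega)
  rw [sub_sub, ← hR]
  refine ⟨(monic_X.mul hP1).sub_of_left hRdeg, ?_, ?_⟩
  · rw [natDegree_sub_eq_left_of_natDegree_lt, hX, sum_add_single]
    omega
  · have hterm : ∀ j, momentTransform l s₂ s₁ s₀ (C ((n j : ℝ) * (s₂ * z j ^ 2 + s₁ * z j + s₀) *
        (l + s₂ * (∑ j, (n j : ℝ) - 1))) * L j) = C (transformCoeff l s₂ (∑ j, n j)) *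
        (C ((n j : ℝ) * (s₂ * z j ^ 2 + s₁ * z j + s₀)) * lowerNodePoly z n j) := by
      intro j
      rw [momentTransform_C_mul]
      by_cases hj : n j = 0
      · simp [hj]
      · have hc : (∑ i, (n i : ℝ)) - 1 = ((∑ i, (n - Pi.single j 1 : Fin r → ℕ) i : ℕ) : ℝ) := by
          have := hsum j hj
          rw [← Nat.cast_sum, this]; push_cast; ring
        rw [(hL j hj).2.2, lowerNodePoly, if_neg hj, hc, hsum j hj]
        conv_rhs => rw [transformCoeff_succ]
        simp only [map_mul]
        ring
    have hs : transformCoeff l s₂ (∑ i, (n + Pi.single k 1 : Fin r → ℕ) i) =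
        transformCoeff l s₂ (∑ i, n i) * (l + s₂ * ∑ j, (n j : ℝ)) := by
      rw [sum_add_single, transformCoeff_succ]
      push_cast; ring
    rw [hR, map_sub, map_add, map_sum, Finset.sum_congr rfl fun j _ => hterm j, ← Finset.mul_sum,
      momentTransform_C_mul, momentTransform_X_mul, hP3, ← smul_eq_C_mul, map_smul,
      raisingOp_nodePoly z n k, hs, smul_eq_C_mul, smul_eq_C_mul]
    simp only [map_mul]
    ring

/-- Running the recurrence as a definition avoids inverting the transform, which fails when
`transformCoeff` vanishes, as it does for Krawtchouk beyond degree `N`. -/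
theorem exists_hasTransform (l s₂ s₁ s₀ : ℝ) (z : Fin r → ℝ) : ∀ (m : ℕ) (n : Fin r → ℕ),
    ∑ j, n j = m → ∃ P, HasTransform l s₂ s₁ s₀ z n P := by
  intro m
  induction m using Nat.strong_induction_on with
  | _ m ih =>
    intro n hn
    rcases m with _ | m
    · have h0 : ∀ j, n j = 0 := fun j => (Finset.sum_eq_zero_iff.mp hn) j (Finset.mem_univ j)
      refine ⟨1, monic_one, by simp [hn], ?_⟩
      simp [momentTransform_one, transformCoeff, nodePoly, h0]
    · obtain ⟨k, -, hk⟩ : ∃ j ∈ Finset.univ, n j ≠ 0 :=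
        Finset.exists_ne_zero_of_sum_ne_zero (by omega)
      obtain ⟨n', rfl⟩ := exists_eq_add_single (Nat.pos_of_ne_zero hk)
      rw [sum_add_single] at hn
      obtain ⟨P, hP⟩ := ih m (by omega) n' (by omega)
      have hex : ∀ j, ∃ L : ℝ[X], (n' j = 0 → L = 0) ∧
          (n' j ≠ 0 → HasTransform l s₂ s₁ s₀ z (n' - Pi.single j 1) L) := by
        intro j
        by_cases hj : n' j = 0
        · exact ⟨0, fun _ => rfl, fun h => absurd hj h⟩
        · obtain ⟨n'', rfl⟩ := exists_eq_add_single (Nat.pos_of_ne_zero hj)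
          rw [sum_add_single] at hn
          obtain ⟨L, hL⟩ := ih (m - 1) (by omega) n'' (by omega)
          exact ⟨L, fun h => absurd h hj, fun _ => by rwa [add_tsub_cancel_right]⟩
      choose L hL0 hL using hex
      exact ⟨_, hP.add_single hL0 hL k⟩

variable {μ : Fin r → Measure ℝ} {z K : Fin r → ℝ}

theorem HasTransform.isTypeII
    (hint : ∀ j (q : ℝ[X]), Integrable (fun x => q.eval x) (μ j))
    (hmom : ∀ j (q : ℝ[X]), ∫ x, q.eval x ∂(μ j) =
      K j * (momentTransform l s₂ s₁ s₀ q).eval (z j))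
    {n : Fin r → ℕ} {P : ℝ[X]} (hP : HasTransform l s₂ s₁ s₀ z n P) : IsTypeII μ n P := by
  refine ⟨hP.1, hP.2.1, fun j k hk => ⟨integrable_pow_mul (hint j) k P, ?_⟩⟩
  have h := hmom j (X ^ k * P)
  rw [eval_momentTransform_eq_zero] at h
  · simpa using h
  · rw [hP.2.2]
    refine Dvd.dvd.mul_left ((pow_dvd_pow _ hk).trans ?_) _
    exact Finset.dvd_prod_of_mem (fun j => (X - C (z j)) ^ n j) (Finset.mem_univ j)

/-- Normality identifies the constructed polynomials with `poly`. It is needed up to `|n| + 1`,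
whence the shift between `D` and `D + 1`. -/
theorem nearestNeighborRecurrence_of_moments
    (hint : ∀ j (q : ℝ[X]), Integrable (fun x => q.eval x) (μ j))
    (hmom : ∀ j (q : ℝ[X]), ∫ x, q.eval x ∂(μ j) =
      K j * (momentTransform l s₂ s₁ s₀ q).eval (z j)) {D : ℕ}
    (hnorm : ∀ n : Fin r → ℕ, ∑ j, n j ≤ D + 1 → IsNormal μ n) {n : Fin r → ℕ}
    (hn : ∑ j, n j ≤ D) :
    NearestNeighborRecurrence μ n
      (fun k => (l + s₂ * ∑ j, (n j : ℝ)) * z k + ∑ j, (n j : ℝ) * (s₂ * z j + s₁))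
      (fun j => (n j : ℝ) * (s₂ * z j ^ 2 + s₁ * z j + s₀) *
        (l + s₂ * (∑ j, (n j : ℝ) - 1))) := by
  have hpoly : ∀ n : Fin r → ℕ, ∑ j, n j ≤ D + 1 →
      HasTransform l s₂ s₁ s₀ z n (poly μ n) := fun n hn => by
    obtain ⟨P, hP⟩ := exists_hasTransform l s₂ s₁ s₀ z _ n rfl
    rwa [← (hnorm n hn).eq_poly (hP.isTypeII hint hmom)]
  intro k
  have hL0 : ∀ j, n j = 0 → lowerPoly μ n j = 0 := fun j hj => by simp [lowerPoly, hj]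
  have hL : ∀ j, n j ≠ 0 →
      HasTransform l s₂ s₁ s₀ z (n - Pi.single j 1) (lowerPoly μ n j) := fun j hj => by
    rw [lowerPoly, if_neg hj]
    refine hpoly _ (le_trans (Finset.sum_le_sum fun i _ => ?_) (hn.trans (Nat.le_succ D)))
    exact Nat.sub_le _ _
  have hstep := (hpoly n (by omega)).add_single hL0 hL k
  have := (hnorm (n + Pi.single k 1) (by rw [sum_add_single]; omega)).eq_poly
    (hstep.isTypeII hint hmom)
  rw [upperPoly, ← this]
  ring

end

/-! ### Measures on the nonnegative integers -/

noncomputable section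

/-- `∑ k, W k δ_k`. -/
def natMeasure (W : ℕ → ℝ) : Measure ℝ :=
  Measure.sum fun k : ℕ => ENNReal.ofReal (W k) • Measure.dirac (k : ℝ)

theorem natMeasure_withDensity {V : ℕ → ℝ} (hV : ∀ k, 0 ≤ V k) (g : ℝ → ℝ) :
    (natMeasure V).withDensity (fun x => ENNReal.ofReal (g x)) =
      natMeasure fun k => V k * g k := by
  rw [natMeasure, natMeasure, withDensity_sum]
  congr 1
  ext1 k
  rw [withDensity_smul_measure, dirac_withDensity, smul_smul, ENNReal.ofReal_mul (hV k)]

theorem natMeasure_ae_iff {W : ℕ → ℝ} {P : ℝ → Prop} :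
    (∀ᵐ x ∂natMeasure W, P x) ↔ ∀ k : ℕ, 0 < W k → P k := by
  rw [natMeasure, Measure.ae_sum_iff]
  refine forall_congr' fun k => ?_
  rcases lt_or_ge 0 (W k) with h | h
  · rw [Measure.ae_ennreal_smul_measure_iff (by simpa using h)]
    simp [h]
  · simp [ENNReal.ofReal_of_nonpos h, not_lt.mpr h]

theorem le_card_roots_of_ae_natMeasure {W : ℕ → ℝ} {D : ℕ} (hW : ∀ k ≤ D, 0 < W k) {p : ℝ[X]}
    (hp : p ≠ 0) (h : ∀ᵐ x ∂natMeasure W, p.eval x = 0) : D + 1 ≤ p.roots.toFinset.card := by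
  rw [natMeasure_ae_iff] at h
  have hsub : (Finset.range (D + 1)).image (Nat.cast : ℕ → ℝ) ⊆ p.roots.toFinset := by
    intro x hx
    obtain ⟨k, hk, rfl⟩ := Finset.mem_image.mp hx
    rw [Multiset.mem_toFinset, mem_roots hp]
    exact h k (hW k (by simpa [Nat.lt_succ_iff] using hk))
  have := Finset.card_le_card hsub
  rwa [Finset.card_image_of_injective _ Nat.cast_injective, Finset.card_range] at this

theorem integrable_natMeasure {W : ℕ → ℝ} (hW : ∀ k, 0 ≤ W k)
    (hs : ∀ i : ℕ, Summable fun k : ℕ => W k * (k : ℝ) ^ i) (q : ℝ[X]) :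
    Integrable (fun x => q.eval x) (natMeasure W) := by
  induction q using Polynomial.induction_on' with
  | add p q hp hq =>
    simp only [eval_add]
    exact hp.add hq
  | monomial i a =>
    refine integrable_sum_dirac (by simp) ?_
    have := (hs i).mul_left |a|
    refine this.congr fun k => ?_
    simp [ENNReal.toReal_ofReal (hW k)]
    ring

theorem hasSum_integral_natMeasure {W : ℕ → ℝ} (hW : ∀ k, 0 ≤ W k) {f : ℝ → ℝ}
    (hf : Integrable f (natMeasure W)) :
    HasSum (fun k : ℕ => W k * f k) (∫ x, f x ∂natMeasure W) := by
  have := hasSum_integral_measure hf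
  simp only [integral_smul_measure, integral_dirac, ENNReal.toReal_ofReal (hW _), smul_eq_mul]
    at this
  exact this

/-- Weights with a Pearson equation of slope less than `1` have moments of all orders. -/
theorem summable_of_pearson {W : ℕ → ℝ} (hW : ∀ k, 0 ≤ W k) {A B : ℝ} (hB : B < 1)
    (hP : ∀ k : ℕ, W (k + 1) * (k + 1) = (A + B * k) * W k) (i : ℕ) :
    Summable fun k : ℕ => W k * (k : ℝ) ^ i := by
  -- The ratio `(A + B k) / (k + 1)` tends to `B`, so from some `N` on it is at most `ρ`, and the
  -- weights are dominated by a geometric sequence.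
  obtain ⟨ρ, hρ, hρ1⟩ := exists_between (max_lt hB one_pos)
  have hρ0 : 0 < ρ := (le_max_right _ _).trans_lt hρ
  have hρB : B < ρ := (le_max_left _ _).trans_lt hρ
  obtain ⟨N, hN⟩ := exists_nat_ge ((A - ρ) / (ρ - B))
  have hstep : ∀ k : ℕ, N ≤ k → W (k + 1) ≤ ρ * W k := by
    intro k hk
    have h1 : (A - ρ) / (ρ - B) ≤ k := hN.trans (by exact_mod_cast hk)
    rw [div_le_iff₀ (by linarith)] at h1
    have h2 : A + B * k ≤ ρ * (k + 1) := by linarith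
    have h3 := mul_le_mul_of_nonneg_right h2 (hW k)
    rw [← hP k] at h3
    have h4 : (0 : ℝ) < k + 1 := by positivity
    refine le_of_mul_le_mul_right (h3.trans_eq ?_) h4
    ring
  have hbound : ∀ m : ℕ, W (m + N) ≤ W N / ρ ^ N * ρ ^ (m + N) := by
    intro m
    induction m with
    | zero => simp [hρ0.ne']
    | succ m ih =>
      rw [Nat.succ_add]
      refine (hstep _ (by omega)).trans ((mul_le_mul_of_nonneg_left ih hρ0.le).trans_eq ?_)
      rw [pow_succ ρ (m + N)]; ring
  have hgeo : Summable fun k : ℕ => (k : ℝ) ^ i * ρ ^ k :=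
    summable_pow_mul_geometric_of_norm_lt_one i (by rwa [Real.norm_of_nonneg hρ0.le])
  rw [← summable_nat_add_iff N]
  refine Summable.of_nonneg_of_le (fun m => mul_nonneg (hW _) (by positivity)) (fun m => ?_)
    (((summable_nat_add_iff N).mpr hgeo).mul_left (W N / ρ ^ N))
  refine (mul_le_mul_of_nonneg_right (hbound m) (by positivity)).trans_eq ?_
  ring

/-- Summation by parts: the term at `0` vanishes, and the Pearson equation rewrites the sum after
the shift `k ↦ k + 1`. -/
theorem integral_X_mul_natMeasure {W : ℕ → ℝ} (hW : ∀ k, 0 ≤ W k)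
    (hint : ∀ q : ℝ[X], Integrable (fun x => q.eval x) (natMeasure W)) {A B : ℝ}
    (hP : ∀ k : ℕ, W (k + 1) * (k + 1) = (A + B * k) * W k) (q : ℝ[X]) :
    ∫ x, (X * q).eval x ∂natMeasure W =
      ∫ x, ((C A + C B * X) * q.comp (X + 1)).eval x ∂natMeasure W := by
  have h1 := hasSum_integral_natMeasure hW (hint (X * q))
  have h2 := hasSum_integral_natMeasure hW (hint ((C A + C B * X) * q.comp (X + 1)))
  rw [← hasSum_nat_add_iff' 1] at h1
  have e : ∑ i ∈ Finset.range 1, W i * (X * q).eval (i : ℝ) = 0 := by simp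
  rw [e, sub_zero] at h1
  refine h1.unique ?_
  refine h2.congr_fun fun k => ?_
  simp only [eval_mul, eval_add, eval_C, eval_X, eval_comp, eval_one]
  push_cast
  linear_combination q.eval (k + 1 : ℝ) * hP k

/-- A linear functional that vanishes on polynomials of every degree is zero. -/
theorem linearMap_eq_zero_of_degree {F : ℝ[X] →ₗ[ℝ] ℝ} {S : ℕ → ℝ[X]}
    (hS : ∀ i, (S i).degree = i) (hF : ∀ i, F (S i) = 0) : F = 0 := by
  let T : Polynomial.Sequence ℝ := ⟨S, hS⟩
  refine LinearMap.ext_on (T.span fun i => ?_) (s := Set.range S) ?_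
  · exact (leadingCoeff_ne_zero.mpr (T.ne_zero i)).isUnit
  · rintro _ ⟨i, rfl⟩
    simpa using hF i

/-- Reduces a moment formula to one convenient polynomial in each degree: falling factorials for
lattice measures, powers for continuous ones. -/
theorem integral_eq_momentTransform {μ : Measure ℝ}
    (hint : ∀ q : ℝ[X], Integrable (fun x => q.eval x) μ) {l s₂ s₁ s₀ K z : ℝ} {S : ℕ → ℝ[X]}
    (hS : ∀ i, (S i).degree = i)
    (hF : ∀ i, ∫ x, (S i).eval x ∂μ = K * (momentTransform l s₂ s₁ s₀ (S i)).eval z) (q : ℝ[X]) :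
    ∫ x, q.eval x ∂μ = K * (momentTransform l s₂ s₁ s₀ q).eval z := by
  let F : ℝ[X] →ₗ[ℝ] ℝ :=
    { toFun := fun q => ∫ x, q.eval x ∂μ - K * (momentTransform l s₂ s₁ s₀ q).eval z
      map_add' := fun p q => by
        simp only [eval_add, map_add]
        rw [integral_add (hint p) (hint q)]; ring
      map_smul' := fun c q => by
        simp only [eval_smul, map_smul, smul_eq_mul, RingHom.id_apply]
        rw [integral_const_mul]; ring }
  have := LinearMap.congr_fun (linearMap_eq_zero_of_degree (F := F) hS fun i => by
    simp [F, hF i]) q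
  exact sub_eq_zero.mp this

theorem degree_descPochhammer (i : ℕ) : (descPochhammer ℝ i).degree = i := by
  rw [degree_eq_natDegree (monic_descPochhammer ℝ i).ne_zero, descPochhammer_natDegree]

/-- For `s₁ = 1`, `s₀ = 0` the term `X d/dX` contributes `i X ^ i`, which the factor `X - i` of the
next falling factorial removes. -/
theorem momentTransform_descPochhammer (l s₂ : ℝ) (i : ℕ) :
    momentTransform l s₂ 1 0 (descPochhammer ℝ i) = C (transformCoeff l s₂ i) * X ^ i := by
  induction i with
  | zero => simp [momentTransform_one, transformCoeff]
  | succ i ih =>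
    have e : descPochhammer ℝ (i + 1) =
        X * descPochhammer ℝ i - C (i : ℝ) * descPochhammer ℝ i := by
      rw [descPochhammer_succ_right, C_eq_natCast]; ring
    rw [e, map_sub, momentTransform_X_mul, momentTransform_C_mul, ih, raisingOp_apply,
      transformCoeff_succ, derivative_C_mul_X_pow]
    rcases i with _ | i
    · simp; ring
    · simp only [Nat.add_sub_cancel, map_mul, map_add, map_zero, map_one]
      ring

/-- The factorial moments satisfy `(1 - B) m_{i+1} = (A + B i) m_i`. The hypotheses on `l`, `s₂`,
`z` turn the ratio into `(l + s₂ i) z`, as for the transform. -/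
theorem integral_natMeasure_eq_momentTransform {W : ℕ → ℝ} (hW : ∀ k, 0 ≤ W k)
    (hint : ∀ q : ℝ[X], Integrable (fun x => q.eval x) (natMeasure W)) {A B l s₂ z : ℝ}
    (hB : B < 1) (hP : ∀ k : ℕ, W (k + 1) * (k + 1) = (A + B * k) * W k)
    (hA : A = (1 - B) * (l * z)) (hBz : B = (1 - B) * (s₂ * z)) (q : ℝ[X]) :
    ∫ x, q.eval x ∂natMeasure W = (∫ _x, (1 : ℝ) ∂natMeasure W) *
      (momentTransform l s₂ 1 0 q).eval z := by
  refine integral_eq_momentTransform hint degree_descPochhammer (fun i => ?_) q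
  induction i with
  | zero => simp [momentTransform_one]
  | succ i ih =>
    rw [momentTransform_descPochhammer] at ih ⊢
    have e : descPochhammer ℝ (i + 1) =
        descPochhammer ℝ i * X - C (i : ℝ) * descPochhammer ℝ i := by
      rw [descPochhammer_succ_right, C_eq_natCast]; ring
    -- Shifting back by one makes `X` times this polynomial the next falling factorial, while its
    -- forward shift is the current one.
    have h1 := integral_X_mul_natMeasure hW hint hP ((descPochhammer ℝ i).comp (X - 1))
    have e2 : ((descPochhammer ℝ i).comp (X - 1)).comp (X + 1) = descPochhammer ℝ i := by
      rw [comp_assoc]; simp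
    have e3 : (C A + C B * X) * descPochhammer ℝ i = C (A + B * i) * descPochhammer ℝ i +
        C B * descPochhammer ℝ (i + 1) := by
      rw [e]; simp only [map_add, map_mul]; ring
    rw [← descPochhammer_succ_left, e2, e3] at h1
    simp only [eval_add, eval_mul, eval_C] at h1
    rw [integral_add ((hint _).const_mul _) ((hint _).const_mul _), integral_const_mul,
      integral_const_mul, ih] at h1
    rw [transformCoeff_succ]
    simp only [eval_mul, eval_C, eval_pow, eval_X] at h1 ⊢
    refine mul_left_cancel₀ (sub_ne_zero.mpr hB.ne') ?_
    have h3 : A + B * i = (1 - B) * ((l + s₂ * i) * z) := by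
      linear_combination hA + i * hBz
    rw [h3] at h1
    rw [pow_succ]
    linear_combination h1

/-! ### The weights of Charlier, Meixner and Krawtchouk -/

theorem charlierMeasure_eq (a : ℝ) :
    charlierMeasure a = natMeasure fun k => a ^ k / (k.factorial : ℝ) := rfl

theorem meixnerMeasure_eq (β c : ℝ) : meixnerMeasure β c =
    natMeasure fun k => (ascPochhammer ℝ k).eval β * c ^ k / (k.factorial : ℝ) := rfl

theorem krawtchoukMeasure_eq (N : ℕ) (p : ℝ) : krawtchoukMeasure N p =
    natMeasure fun k => (N.choose k : ℝ) * p ^ k * (1 - p) ^ (N - k) := by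
  ext s hs
  rw [natMeasure, krawtchoukMeasure, Measure.sum_apply _ hs,
    tsum_eq_sum (s := Finset.range (N + 1)), Measure.finsetSum_apply]
  intro k hk
  have : N.choose k = 0 := Nat.choose_eq_zero_of_lt (by simpa using hk)
  simp [this]

theorem charlier_pearson (a : ℝ) (k : ℕ) :
    a ^ (k + 1) / ((k + 1).factorial : ℝ) * (k + 1) =
      (a + 0 * k) * (a ^ k / (k.factorial : ℝ)) := by
  have := Nat.factorial_pos k
  rw [Nat.factorial_succ]; push_cast
  field_simp
  ring

theorem meixner_pearson (β c : ℝ) (k : ℕ) :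
    (ascPochhammer ℝ (k + 1)).eval β * c ^ (k + 1) / ((k + 1).factorial : ℝ) * (k + 1) =
      (c * β + c * k) * ((ascPochhammer ℝ k).eval β * c ^ k / (k.factorial : ℝ)) := by
  have := Nat.factorial_pos k
  rw [Nat.factorial_succ, ascPochhammer_succ_eval]; push_cast
  field_simp
  ring

theorem krawtchouk_pearson (N : ℕ) {p : ℝ} (hp : p < 1) (k : ℕ) :
    (N.choose (k + 1) : ℝ) * p ^ (k + 1) * (1 - p) ^ (N - (k + 1)) * (k + 1) =
      (p / (1 - p) * N + -(p / (1 - p)) * k) *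
        ((N.choose k : ℝ) * p ^ k * (1 - p) ^ (N - k)) := by
  have hp' : 1 - p ≠ 0 := by linarith
  rcases lt_or_ge k N with h | h
  · have h1 : ((N.choose (k + 1) : ℝ)) * (k + 1) = N.choose k * (N - k) := by
      have := N.choose_succ_right_eq k
      rw [← Nat.cast_sub h.le]; exact_mod_cast this
    obtain ⟨m, rfl⟩ := Nat.exists_eq_add_of_lt h
    have e1 : k + m + 1 - (k + 1) = m := by omega
    have e2 : k + m + 1 - k = m + 1 := by omega
    rw [e1, e2]
    field_simp
    rw [pow_succ, pow_succ]
    linear_combination (p ^ k * p * (1 - p) ^ m * (1 - p)) * h1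
  -- From `k = N` on the left side is zero; on the right, the factor `N - k` vanishes at `k = N` and
  -- the binomial coefficient beyond.
  · rw [Nat.choose_eq_zero_of_lt (by omega)]
    rcases h.eq_or_lt with rfl | h
    · ring
    · rw [Nat.choose_eq_zero_of_lt h]; ring

end

noncomputable section

/-! ### Exponential families -/

theorem exp_family {μ : Fin r → Measure ℝ} {I : Set ℝ} (hAT : IsATSystem μ I)
    (hint : ∀ j (q : ℝ[X]), Integrable (fun x => q.eval x) (μ j)) {D : ℕ}
    (hsupp : ∀ j (p : ℝ[X]), p ≠ 0 → (∀ᵐ x ∂μ j, p.eval x = 0) →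
      D + 1 ≤ p.roots.toFinset.card) {l s₂ s₁ s₀ : ℝ} {z K : Fin r → ℝ}
    (hmom : ∀ j (q : ℝ[X]), ∫ x, q.eval x ∂(μ j) =
      K j * (momentTransform l s₂ s₁ s₀ q).eval (z j)) :
    (∀ n : Fin r → ℕ, ∑ j, n j ≤ D + 1 → IsNormal μ n) ∧
    ∀ n : Fin r → ℕ, ∑ j, n j ≤ D →
      NearestNeighborRecurrence μ n
        (fun k => (l + s₂ * ∑ j, (n j : ℝ)) * z k + ∑ j, (n j : ℝ) * (s₂ * z j + s₁))
        (fun j => (n j : ℝ) * (s₂ * z j ^ 2 + s₁ * z j + s₀) *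
          (l + s₂ * (∑ j, (n j : ℝ) - 1))) ∧
      ∀ k, Interlace (poly μ n) (upperPoly μ n k) := by
  obtain ⟨h1, h2⟩ := hAT.isNormal_and_interlace hint hsupp
  exact ⟨h1, fun n hn => ⟨nearestNeighborRecurrence_of_moments hint hmom h1 hn, h2 n hn⟩⟩

/-- Two descriptions of the same weights enter: the Pearson equation gives the moments, and the
exponential form against the common `V` gives the AT property. -/
theorem natMeasure_exp_family {W : Fin r → ℕ → ℝ} (hW : ∀ j k, 0 ≤ W j k) {A B : Fin r → ℝ}
    (hB : ∀ j, B j < 1) (hP : ∀ j, ∀ k : ℕ, W j (k + 1) * (k + 1) = (A j + B j * k) * W j k)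
    {l s₂ : ℝ} {z : Fin r → ℝ} (hA : ∀ j, A j = (1 - B j) * (l * z j))
    (hBz : ∀ j, B j = (1 - B j) * (s₂ * z j)) {V : ℕ → ℝ} (hV : ∀ k, 0 ≤ V k) {c K : Fin r → ℝ}
    (hc : Function.Injective c) (hK : ∀ j, 0 < K j)
    (hWV : ∀ j, ∀ k : ℕ, W j k = V k * (K j * Real.exp (c j * k))) {D : ℕ}
    (hpos : ∀ j, ∀ k ≤ D, 0 < W j k) {μ : Fin r → Measure ℝ} (hμ : ∀ j, μ j = natMeasure (W j)) :
    (∀ n : Fin r → ℕ, ∑ j, n j ≤ D + 1 → IsNormal μ n) ∧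
    ∀ n : Fin r → ℕ, ∑ j, n j ≤ D →
      NearestNeighborRecurrence μ n
        (fun k => (l + s₂ * ∑ j, (n j : ℝ)) * z k + ∑ j, (n j : ℝ) * (s₂ * z j + 1))
        (fun j => (n j : ℝ) * (s₂ * z j ^ 2 + 1 * z j + 0) *
          (l + s₂ * (∑ j, (n j : ℝ) - 1))) ∧
      ∀ k, Interlace (poly μ n) (upperPoly μ n k) := by
  obtain rfl : μ = fun j => natMeasure (W j) := funext hμ
  have hint : ∀ j (q : ℝ[X]), Integrable (fun x => q.eval x) (natMeasure (W j)) := fun j q =>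
    integrable_natMeasure (hW j) (summable_of_pearson (hW j) (hB j) (hP j)) q
  refine exp_family (isATSystem_exp hc hK (natMeasure V) fun j => ?_) hint
    (fun j p hp h => le_card_roots_of_ae_natMeasure (hpos j) hp h)
    (fun j q => integral_natMeasure_eq_momentTransform (hW j) (hint j) (hB j) (hP j) (hA j)
      (hBz j) q)
  rw [natMeasure_withDensity hV fun x => K j * Real.exp (c j * x)]
  congr 1
  exact funext (hWV j)

/-! ### Absolutely continuous measures -/

theorem not_ae_eval_eq_zero {ν : Measure ℝ} [NullSingletonClass ν] (hν : ν ≠ 0) {p : ℝ[X]}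
    (hp : p ≠ 0) : ¬ ∀ᵐ x ∂ν, p.eval x = 0 := by
  intro h
  have h1 : ν {x | p.eval x = 0} = 0 :=
    ((p.roots.toFinset.finite_toSet).subset fun x hx => by simpa [hp] using hx).measure_zero ν
  have h2 : ∀ᵐ x ∂ν, p.eval x ≠ 0 := by
    rw [ae_iff]; simpa using h1
  refine hν (ae_eq_bot.mp (Filter.empty_mem_iff_bot.mp ?_))
  filter_upwards [h, h2] with x h3 h4 using h4 h3

/-- Integration against a real density. -/
theorem integrable_withDensity_ofReal {ν : Measure ℝ} {w : ℝ → ℝ} (hw : Measurable w)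
    (hw0 : ∀ᵐ x ∂ν, 0 ≤ w x) {f : ℝ → ℝ} :
    Integrable f (ν.withDensity fun x => ENNReal.ofReal (w x)) ↔
      Integrable (fun x => w x * f x) ν := by
  rw [integrable_withDensity_iff_integrable_smul' hw.ennreal_ofReal (by simp)]
  refine integrable_congr ?_
  filter_upwards [hw0] with x hx
  rw [ENNReal.toReal_ofReal hx, smul_eq_mul]

theorem integral_withDensity_ofReal {ν : Measure ℝ} {w : ℝ → ℝ} (hw : Measurable w)
    (hw0 : ∀ᵐ x ∂ν, 0 ≤ w x) (f : ℝ → ℝ) :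
    ∫ x, f x ∂(ν.withDensity fun x => ENNReal.ofReal (w x)) = ∫ x, w x * f x ∂ν := by
  rw [integral_withDensity_eq_integral_toReal_smul hw.ennreal_ofReal (by simp)]
  refine integral_congr_ae ?_
  filter_upwards [hw0] with x hx
  rw [ENNReal.toReal_ofReal hx, smul_eq_mul]

theorem not_ae_withDensity {ν : Measure ℝ} [NullSingletonClass ν] (hν : ν ≠ 0) {w : ℝ → ℝ}
    (hw : Measurable w) (hw0 : ∀ᵐ x ∂ν, 0 < w x) {p : ℝ[X]} (hp : p ≠ 0) :
    ¬ ∀ᵐ x ∂(ν.withDensity fun x => ENNReal.ofReal (w x)), p.eval x = 0 := by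
  intro h
  refine not_ae_eval_eq_zero hν hp ((withDensity_absolutelyContinuous'
    hw.ennreal_ofReal.aemeasurable ?_).ae_le h)
  filter_upwards [hw0] with x hx
  simpa using hx

/-! ### Hermite weights -/

theorem integrable_eval_mul_gaussian (q : ℝ[X]) :
    Integrable fun x : ℝ => Real.exp (-x ^ 2) * q.eval x := by
  induction q using Polynomial.induction_on' with
  | add p q hp hq =>
    simp only [eval_add, mul_add]
    exact hp.add hq
  | monomial i a =>
    have h := (integrable_rpow_mul_exp_neg_mul_sq one_pos (s := i)
      (by have := Nat.cast_nonneg (α := ℝ) i; linarith)).const_mul a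
    refine h.congr (Filter.Eventually.of_forall fun x => ?_)
    simp
    ring

theorem integrable_hermite (c : ℝ) (q : ℝ[X]) :
    Integrable (fun x => q.eval x) (hermiteMeasure c) := by
  rw [hermiteMeasure, integrable_withDensity_ofReal (by fun_prop)
    (Filter.Eventually.of_forall fun x => (Real.exp_pos _).le)]
  -- Completing the square moves the Gaussian to the centre `c / 2`.
  have h := ((integrable_eval_mul_gaussian (q.comp (X + C (c / 2)))).comp_sub_right
    (c / 2)).const_mul (Real.exp (c ^ 2 / 4))
  refine h.congr (Filter.Eventually.of_forall fun x => ?_)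
  simp only [eval_comp, eval_add, eval_X, eval_C, sub_add_cancel]
  rw [← mul_assoc, ← Real.exp_add]
  congr 2
  ring

/-- Integration by parts: the derivative of `q` times the weight has integral zero. -/
theorem integral_hermite_X_mul (c : ℝ) (q : ℝ[X]) :
    ∫ x, (X * q).eval x ∂hermiteMeasure c = c / 2 * ∫ x, q.eval x ∂hermiteMeasure c +
      1 / 2 * ∫ x, (derivative q).eval x ∂hermiteMeasure c := by
  have hw : Measurable fun x : ℝ => Real.exp (-x ^ 2 + c * x) := by fun_prop
  have hw0 : ∀ᵐ x : ℝ, 0 ≤ Real.exp (-x ^ 2 + c * x) :=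
    Filter.Eventually.of_forall fun x => (Real.exp_pos _).le
  have hint := integrable_hermite c
  have hI : ∀ q : ℝ[X], Integrable fun x : ℝ => Real.exp (-x ^ 2 + c * x) * q.eval x := fun q =>
    (integrable_withDensity_ofReal hw hw0).mp (hint q)
  have h0 : ∫ x, (derivative q + C c * q - C 2 * (X * q)).eval x ∂hermiteMeasure c = 0 := by
    rw [hermiteMeasure, integral_withDensity_ofReal hw hw0]
    refine integral_eq_zero_of_hasDerivAt_of_integrable (fun x => ?_) (hI _) (hI q)
    have h1 : HasDerivAt (fun x : ℝ => Real.exp (-x ^ 2 + c * x))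
        (Real.exp (-x ^ 2 + c * x) * (-(2 * x) + c)) x := by
      have h2 : HasDerivAt (fun x : ℝ => -x ^ 2 + c * x) (-(2 * x) + c) x := by
        have h3 := ((hasDerivAt_pow 2 x).neg).add ((hasDerivAt_id x).const_mul c)
        exact h3.congr_deriv (by simp)
      exact h2.exp
    refine (h1.mul (q.hasDerivAt x)).congr_deriv ?_
    simp
    ring
  simp only [eval_sub, eval_add, eval_C_mul] at h0
  have hadd : Integrable (fun x => (derivative q).eval x + c * q.eval x) (hermiteMeasure c) :=
    (hint _).add ((hint _).const_mul _)
  rw [integral_sub hadd ((hint _).const_mul _),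
    integral_add (hint _) ((hint _).const_mul _), integral_const_mul, integral_const_mul] at h0
  linarith

/-- Integration by parts produces the integral of `q'`, whereas the raising operator produces the
derivative of the transform. On powers the two agree up to the factor `1 / 2`. -/
theorem derivative_momentTransform_hermite (i : ℕ) :
    derivative (momentTransform (1 / 2) 0 0 1 (X ^ (i + 1))) =
      C (((i : ℝ) + 1) / 2) * momentTransform (1 / 2) 0 0 1 (X ^ i) := by
  induction i with
  | zero =>
    rw [zero_add, pow_one, ← mul_one (X : ℝ[X]), momentTransform_X_mul, momentTransform_one,
      raisingOp_apply, pow_zero, momentTransform_one]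
    simp
  | succ i ih =>
    have e1 : momentTransform (1 / 2) 0 0 1 (X ^ (i + 1 + 1)) = C (1 / 2) * X *
        momentTransform (1 / 2) 0 0 1 (X ^ (i + 1)) +
        C (((i : ℝ) + 1) / 2) * momentTransform (1 / 2) 0 0 1 (X ^ i) := by
      rw [pow_succ' X (i + 1), momentTransform_X_mul, raisingOp_apply, ih]
      simp
    have e2 : momentTransform (1 / 2) 0 0 1 (X ^ (i + 1)) = C (1 / 2) * X *
        momentTransform (1 / 2) 0 0 1 (X ^ i) +
        derivative (momentTransform (1 / 2) 0 0 1 (X ^ i)) := by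
      rw [pow_succ' X i, momentTransform_X_mul, raisingOp_apply]
      simp
    rw [e1, derivative_add, derivative_mul, ih, derivative_C_mul, derivative_C_mul, derivative_X]
    have e3 : (C ((((i + 1 : ℕ) : ℝ) + 1) / 2) : ℝ[X]) = C (1 / 2) + C (((i : ℝ) + 1) / 2) := by
      rw [← C_add]; congr 1; push_cast; ring
    rw [e3]
    linear_combination (-C (((i : ℝ) + 1) / 2)) * e2

theorem integral_hermite (c : ℝ) (q : ℝ[X]) :
    ∫ x, q.eval x ∂hermiteMeasure c = (∫ _x, (1 : ℝ) ∂hermiteMeasure c) *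
      (momentTransform (1 / 2) 0 0 1 q).eval c := by
  refine integral_eq_momentTransform (integrable_hermite c) (S := fun i => X ^ i)
    (fun i => degree_X_pow i) (fun i => ?_) q
  induction i using Nat.strong_induction_on with
  | _ i ih =>
    rcases i with _ | i
    · simp [momentTransform_one]
    · have h1 := ih i (by omega)
      simp only [pow_succ' X i]
      rw [integral_hermite_X_mul, h1, momentTransform_X_mul, raisingOp_apply]
      rcases i with _ | i
      · simp [momentTransform_one]
        ring
      · rw [derivative_momentTransform_hermite]
        have h2 := ih i (by omega)
        simp only [derivative_X_pow_succ, eval_mul, eval_C, eval_add] at h2 ⊢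
        rw [integral_const_mul, h2]
        simp
        ring

/-! ### Laguerre weights -/

theorem laguerreMeasure_eq (α c : ℝ) : laguerreMeasure α c =
    (volume.restrict (Set.Ioi 0)).withDensity
      fun x => ENNReal.ofReal (x ^ α * Real.exp (-(c * x))) := by
  rw [laguerreMeasure, Measure.restrict_congr_set Ioi_ae_eq_Ici]

theorem ae_pos_restrict_Ioi : ∀ᵐ x : ℝ ∂(volume.restrict (Set.Ioi (0 : ℝ))), 0 < x :=
  ae_restrict_mem measurableSet_Ioi

theorem integrable_laguerre {α c : ℝ} (hα : -1 < α) (hc : 0 < c) (q : ℝ[X]) :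
    Integrable (fun x => q.eval x) (laguerreMeasure α c) := by
  rw [laguerreMeasure_eq, integrable_withDensity_ofReal (by fun_prop)
    (ae_pos_restrict_Ioi.mono fun x hx => by positivity)]
  induction q using Polynomial.induction_on' with
  | add p q hp hq =>
    simp only [eval_add, mul_add]
    exact hp.add hq
  | monomial i a =>
    have h := (integrableOn_rpow_mul_exp_neg_mul_rpow (p := 1) (s := α + i) (b := c)
      (by have := Nat.cast_nonneg (α := ℝ) i; linarith) one_pos hc).const_mul a
    refine h.congr (ae_pos_restrict_Ioi.mono fun x hx => ?_)
    simp only [Real.rpow_add hx, Real.rpow_natCast, Real.rpow_one, eval_monomial]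
    ring_nf

theorem integral_laguerre_pow {α c : ℝ} (hα : -1 < α) (hc : 0 < c) (i : ℕ) :
    ∫ x, (X ^ i : ℝ[X]).eval x ∂laguerreMeasure α c =
      (1 / c) ^ (α + 1 + i) * Real.Gamma (α + 1 + i) := by
  rw [laguerreMeasure_eq, integral_withDensity_ofReal (by fun_prop)
    (ae_pos_restrict_Ioi.mono fun x hx => by positivity),
    ← Real.integral_rpow_mul_exp_neg_mul_Ioi
      (by have := Nat.cast_nonneg (α := ℝ) i; linarith) hc]
  refine integral_congr_ae (ae_pos_restrict_Ioi.mono fun x hx => ?_)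
  have e : α + 1 + i - 1 = α + i := by ring
  simp only [e, Real.rpow_add hx, Real.rpow_natCast, eval_pow, eval_X]
  ring

theorem momentTransform_laguerre (l : ℝ) (i : ℕ) :
    momentTransform l 1 0 0 (X ^ i) = C (transformCoeff l 1 i) * X ^ i := by
  induction i with
  | zero => simp [momentTransform_one, transformCoeff]
  | succ i ih =>
    rw [pow_succ' X i, momentTransform_X_mul, ih, raisingOp_apply, transformCoeff_succ,
      derivative_C_mul_X_pow]
    rcases i with _ | i
    · simp; ring
    · simp only [Nat.add_sub_cancel, map_mul, map_add, map_zero, map_one]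
      ring

theorem gamma_add_nat {a : ℝ} (ha : 0 < a) (i : ℕ) :
    Real.Gamma (a + i) = transformCoeff a 1 i * Real.Gamma a := by
  induction i with
  | zero => simp [transformCoeff]
  | succ i ih =>
    have h : a + (i : ℝ) ≠ 0 := by positivity
    rw [transformCoeff_succ]
    push_cast
    rw [← add_assoc, Real.Gamma_add_one h, ih]
    ring

theorem integral_laguerre {α c : ℝ} (hα : -1 < α) (hc : 0 < c) (q : ℝ[X]) :
    ∫ x, q.eval x ∂laguerreMeasure α c = ((1 / c) ^ (α + 1) * Real.Gamma (α + 1)) *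
      (momentTransform (α + 1) 1 0 0 q).eval (1 / c) := by
  refine integral_eq_momentTransform (integrable_laguerre hα hc) (S := fun i => X ^ i)
    (fun i => degree_X_pow i) (fun i => ?_) q
  rw [integral_laguerre_pow hα hc, momentTransform_laguerre, gamma_add_nat (by linarith),
    Real.rpow_add (by positivity), Real.rpow_natCast]
  simp
  ring

theorem not_ae_laguerre {α c : ℝ} {p : ℝ[X]} (hp : p ≠ 0) :
    ¬ ∀ᵐ x ∂laguerreMeasure α c, p.eval x = 0 := by
  rw [laguerreMeasure_eq]
  refine not_ae_withDensity (fun h => ?_) (by fun_prop)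
    (ae_pos_restrict_Ioi.mono fun x hx => by positivity) hp
  rw [Measure.restrict_eq_zero] at h
  simp at h

theorem not_ae_hermite {c : ℝ} {p : ℝ[X]} (hp : p ≠ 0) :
    ¬ ∀ᵐ x ∂hermiteMeasure c, p.eval x = 0 :=
  not_ae_withDensity (NeZero.ne _) (by fun_prop)
    (Filter.Eventually.of_forall fun x => Real.exp_pos _) hp

/-! ### AT property of the Hermite and Laguerre families -/

theorem isATSystem_hermite {c : Fin r → ℝ} (hc : Function.Injective c) :
    IsATSystem (fun j => hermiteMeasure (c j)) Set.univ := by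
  refine isATSystem_exp hc (K := fun _ => 1) (fun _ => one_pos)
    (volume.withDensity fun x => ENNReal.ofReal (Real.exp (-x ^ 2))) fun j => ?_
  rw [← withDensity_mul _ (by fun_prop) (by fun_prop), hermiteMeasure]
  congr 1
  ext1 x
  rw [Pi.mul_apply, ← ENNReal.ofReal_mul (Real.exp_pos _).le, one_mul, Real.exp_add]

theorem isATSystem_laguerre_second {α : ℝ} {c : Fin r → ℝ} (hc : Function.Injective c) :
    IsATSystem (fun j => laguerreMeasure α (c j)) Set.univ := by
  refine isATSystem_exp (c := fun j => -c j) (fun i j h => hc (neg_injective h)) (K := fun _ => 1)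
    (fun _ => one_pos) ((volume.restrict (Set.Ioi 0)).withDensity
      fun x => ENNReal.ofReal (x ^ α)) fun j => ?_
  rw [← withDensity_mul _ (by fun_prop) (by fun_prop), laguerreMeasure_eq]
  congr 1
  ext1 x
  rw [Pi.mul_apply, ENNReal.ofReal_mul' (Real.exp_pos _).le, one_mul, neg_mul]

theorem isATSystem_laguerre_first {α : Fin r → ℝ}
    (hα : ∀ i j, i ≠ j → ∀ z : ℤ, α i - α j ≠ (z : ℝ)) :
    IsATSystem (fun j => laguerreMeasure (α j) 1) (Set.Ioi 0) := by
  refine isATSystem_rpow hα ((volume.restrict (Set.Ioi 0)).withDensity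
    fun x => ENNReal.ofReal (Real.exp (-x))) ?_ fun j => ?_
  · exact withDensity_absolutelyContinuous _ _ (by simp [Set.Iic_inter_Ioi])
  · rw [← withDensity_mul _ (by fun_prop) (by fun_prop), laguerreMeasure_eq]
    congr 1
    ext1 x
    rw [Pi.mul_apply, ENNReal.ofReal_mul' (Real.exp_pos _).le, one_mul, mul_comm]

end

noncomputable section

/-! ### Gamma weights -/

theorem eval_ascPochhammer_eq (a : ℝ) (i : ℕ) :
    (ascPochhammer ℝ i).eval a = transformCoeff a 1 i := by
  induction i with
  | zero => simp [transformCoeff]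
  | succ i ih => rw [ascPochhammer_succ_eval, ih, transformCoeff_succ, one_mul]

theorem degree_ascPochhammer_comp (β : ℝ) (i : ℕ) :
    ((ascPochhammer ℝ i).comp (X + C β)).degree = i := by
  have hm : ((ascPochhammer ℝ i).comp (X + C β)).Monic :=
    (monic_ascPochhammer ℝ i).comp_X_add_C β
  rw [degree_eq_natDegree hm.ne_zero, natDegree_comp, natDegree_X_add_C, mul_one,
    ascPochhammer_natDegree]

/-- A polynomial multiple of `Γ (x + β)` is the Mellin transform of a polynomial multiple of
`t ^ β e ^ (-t)`. -/
theorem exists_mellin_polynomial {β : ℝ} (hβ : 0 < β) {n : ℕ} {A : ℝ[X]}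
    (hA : A.degree < (n : WithBot ℕ)) :
    ∃ q : ℝ[X], q.degree < (n : WithBot ℕ) ∧ ∀ x, 0 ≤ x →
      ∫ t, q.eval t ∂laguerreMeasure (x + β - 1) 1 = A.eval x * Real.Gamma (x + β) := by
  -- The shifted rising factorials satisfy `(x + β)_i Γ(x + β) = Γ(x + β + i)`, which is the `i`-th
  -- moment of the Laguerre weight, so powers of `t` correspond to them.
  let S : Polynomial.Sequence ℝ := ⟨fun i => (ascPochhammer ℝ i).comp (X + C β),
    degree_ascPochhammer_comp β⟩
  have hspan := S.span_degreeLT (m := n) fun i _ =>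
    (leadingCoeff_ne_zero.mpr (S.ne_zero i)).isUnit
  rw [← mem_degreeLT, ← hspan] at hA
  have hint : ∀ x, 0 ≤ x → ∀ q : ℝ[X],
      Integrable (fun t => q.eval t) (laguerreMeasure (x + β - 1) 1) := fun x hx q =>
    integrable_laguerre (by linarith) one_pos q
  induction hA using Submodule.span_induction with
  | mem A hA =>
    obtain ⟨i, hi, rfl⟩ := hA
    refine ⟨X ^ i, by rw [degree_X_pow]; exact_mod_cast hi, fun x hx => ?_⟩
    have e : x + β - 1 + 1 = x + β := by ring
    rw [integral_laguerre_pow (by linarith) one_pos, e, gamma_add_nat (by linarith),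
      ← eval_ascPochhammer_eq]
    change _ = ((ascPochhammer ℝ i).comp (X + C β)).eval x * _
    simp
  | zero => exact ⟨0, by simp, fun x hx => by simp⟩
  | add A B _ _ hA hB =>
    obtain ⟨p, hp, hp'⟩ := hA
    obtain ⟨q, hq, hq'⟩ := hB
    refine ⟨p + q, (degree_add_le _ _).trans_lt (max_lt hp hq), fun x hx => ?_⟩
    simp only [eval_add]
    rw [integral_add (hint x hx p) (hint x hx q), hp' x hx, hq' x hx]
    ring
  | smul a A _ hA =>
    obtain ⟨p, hp, hp'⟩ := hA
    refine ⟨a • p, (degree_smul_le _ _).trans_lt hp, fun x hx => ?_⟩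
    simp only [eval_smul, smul_eq_mul]
    rw [integral_const_mul, hp' x hx]
    ring

theorem isTSystem_rpow {N : ℕ} {c : Fin N → ℝ} (hc : Function.Injective c) :
    IsTSystem (Set.Ioi 0) fun i t => t ^ c i := by
  refine ⟨fun i t ht => (Real.continuousAt_rpow_const _ _
    (Or.inl (ne_of_gt ht))).continuousWithinAt, fun a ha => ?_⟩
  simpa using encard_zeros_rpow_sum_lt hc ha

/-- The sum is the Mellin transform of `f(t) = ∑ q_j(t) t ^ β_j e ^ (-t)`, which has fewer than
`|n|` zeros on the half-line. A zero `x` of the transform makes `f` orthogonal to `t ^ (x - 1)`. Too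
many zeros would give a Chebyshev system of powers orthogonal to `f` and force `f = 0` almost
everywhere. -/
theorem encard_zeros_gamma_lt {β : Fin r → ℝ} (hβ : ∀ j, 0 < β j)
    (hβ' : ∀ i j, i ≠ j → ∀ z : ℤ, β i - β j ≠ (z : ℝ)) (n : Fin r → ℕ) {A : Fin r → ℝ[X]}
    (hA : ∀ j, (A j).degree < (n j : WithBot ℕ)) (hA0 : A ≠ 0) :
    {x ∈ Set.Ici (0 : ℝ) | ∑ j, (A j).eval x * Real.Gamma (x + β j) = 0}.encard <
      ((∑ j, n j : ℕ) : ℕ∞) := by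
  choose q hq hqA using fun j => exists_mellin_polynomial (hβ j) (hA j)
  have hq0 : q ≠ 0 := by
    rintro rfl
    refine hA0 (funext fun j => eq_zero_of_infinite_isRoot _
      ((Set.Ici_infinite (0 : ℝ)).mono fun x hx => ?_))
    have h := hqA j x hx
    have hG := (Real.Gamma_pos_of_pos (add_pos_of_nonneg_of_pos hx (hβ j))).ne'
    simpa [hG] using h
  set f : ℝ → ℝ := fun t => (∑ j, (q j).eval t * t ^ β j) * Real.exp (-t)
  have hfz := encard_zeros_rpow_lt hβ' n hq hq0
  have hfset : {t ∈ Set.Ioi (0 : ℝ) | ∑ j, (q j).eval t * t ^ β j = 0} =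
      {t ∈ Set.Ioi (0 : ℝ) | f t = 0} := by
    ext t; simp [f]
  rw [hfset] at hfz
  have hfin := Set.finite_of_encard_le_coe hfz.le
  have hfc : ContinuousOn f (Set.Ioi 0) := by
    refine ContinuousOn.mul (continuousOn_finsetSum _ fun j _ => ?_) (by fun_prop)
    exact (q j).continuous.continuousOn.mul fun t ht =>
      (Real.continuousAt_rpow_const _ _ (Or.inl (ne_of_gt ht))).continuousWithinAt
  obtain ⟨S, hS, hS0, hsgn⟩ := exists_sign_set _ Set.ordConnected_Ioi hfc hfin.toFinset
    (fun t ht h0 => by simpa using ⟨ht, h0⟩) le_rfl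
  have hScard : S.card < ∑ j, n j := by
    refine (Finset.card_le_card hS).trans_lt ?_
    rw [hfin.encard_eq_coe_toFinset_card] at hfz
    exact_mod_cast hfz
  have hterm : ∀ x, 0 ≤ x → ∀ j,
      IntegrableOn (fun t => (q j).eval t * t ^ β j * Real.exp (-t) * t ^ (x - 1)) (Set.Ioi 0) ∧
      ∫ t in Set.Ioi 0, (q j).eval t * t ^ β j * Real.exp (-t) * t ^ (x - 1) =
        (A j).eval x * Real.Gamma (x + β j) := by
    intro x hx j
    have hae : (fun t : ℝ => t ^ (x + β j - 1) * Real.exp (-(1 * t)) * (q j).eval t)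
        =ᵐ[volume.restrict (Set.Ioi 0)]
        fun t => (q j).eval t * t ^ β j * Real.exp (-t) * t ^ (x - 1) := by
      refine ae_pos_restrict_Ioi.mono fun t ht => ?_
      have e : x + β j - 1 = β j + (x - 1) := by ring
      simp only [e, Real.rpow_add ht, one_mul]
      ring
    have hn0 : ∀ᵐ t : ℝ ∂(volume.restrict (Set.Ioi (0 : ℝ))),
        0 ≤ t ^ (x + β j - 1) * Real.exp (-(1 * t)) :=
      ae_pos_restrict_Ioi.mono fun t ht => by positivity
    have h1 := integrable_laguerre (α := x + β j - 1) (by linarith [hβ j]) one_pos (q j)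
    have h2 := hqA j x hx
    rw [laguerreMeasure_eq, integrable_withDensity_ofReal (by fun_prop) hn0] at h1
    rw [laguerreMeasure_eq, integral_withDensity_ofReal (by fun_prop) hn0,
      integral_congr_ae hae] at h2
    exact ⟨h1.congr hae, h2⟩
  have hf : ∀ x : ℝ, (fun t => f t * t ^ (x - 1)) =
      fun t => ∑ j, (q j).eval t * t ^ β j * Real.exp (-t) * t ^ (x - 1) := fun x => by
    ext t
    simp only [f, Finset.sum_mul]
  by_contra! hcon
  -- One zero more than the number of sign changes of `f` already suffices.
  obtain ⟨Z, hZ, hZcard⟩ := Set.exists_subset_encard_eq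
    ((show ((S.card + 1 : ℕ) : ℕ∞) ≤ ((∑ j, n j : ℕ) : ℕ∞) by exact_mod_cast hScard).trans hcon)
  have hZfin : Z.Finite := Set.finite_of_encard_eq_coe hZcard
  have hZc : hZfin.toFinset.card = S.card + 1 := by
    rw [hZfin.encard_eq_coe_toFinset_card] at hZcard
    exact_mod_cast hZcard
  set x := hZfin.toFinset.orderEmbOfFin hZc
  have hx : ∀ i, 0 ≤ x i ∧ ∑ j, (A j).eval (x i) * Real.Gamma (x i + β j) = 0 := fun i =>
    hZ (hZfin.mem_toFinset.mp (Finset.orderEmbOfFin_mem _ hZc i))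
  have hT : IsTSystem (Set.Ioi 0) fun (i : Fin (S.card + 1)) t => t ^ (x i - 1) :=
    isTSystem_rpow fun i j h => x.injective (by simpa using h)
  have h0 := hT.ae_eq_zero_of_orthogonal Set.ordConnected_Ioi rfl hS0 hsgn
    (ν := volume.restrict (Set.Ioi 0)) (by simp [Set.Iic_inter_Ioi])
    (fun i => by rw [hf]; exact integrable_finsetSum _ fun j _ => (hterm _ (hx i).1 j).1)
    (fun i => by
      rw [hf, integral_finsetSum _ fun j _ => (hterm _ (hx i).1 j).1]
      refine Eq.trans ?_ (hx i).2
      exact Finset.sum_congr rfl fun j _ => (hterm _ (hx i).1 j).2)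
  have h1 : ∀ᵐ t ∂(volume.restrict (Set.Ioi (0 : ℝ))), t ∉ {t ∈ Set.Ioi (0 : ℝ) | f t = 0} :=
    measure_eq_zero_iff_ae_notMem.mp (hfin.measure_zero _)
  have h2 : volume.restrict (Set.Ioi (0 : ℝ)) = 0 := by
    refine ae_eq_bot.mp (Filter.empty_mem_iff_bot.mp ?_)
    filter_upwards [h0, h1, ae_pos_restrict_Ioi] with t h3 h4 h5 using h4 ⟨h5, h3⟩
  rw [Measure.restrict_eq_zero] at h2
  simp at h2

theorem isATSystem_meixner_second {β : Fin r → ℝ} {c : ℝ} (hβ : ∀ j, 0 < β j) (hc : 0 < c)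
    (hβ' : ∀ i j, i ≠ j → ∀ z : ℤ, β i - β j ≠ (z : ℝ)) :
    IsATSystem (fun j => meixnerMeasure (β j) c) (Set.Ici 0) := by
  have hG : ∀ j, 0 < Real.Gamma (β j) := fun j => Real.Gamma_pos_of_pos (hβ j)
  -- Truncating at `0` makes the weight continuous, hence measurable, on the whole line without
  -- changing it on `[0, ∞)`.
  have hcont : ∀ j, Continuous fun x : ℝ => Real.Gamma (max x 0 + β j) / Real.Gamma (β j) := by
    intro j
    refine Continuous.div_const (continuous_iff_continuousAt.mpr fun x => ?_) _
    have h : 0 < max x 0 + β j := add_pos_of_nonneg_of_pos (le_max_right _ _) (hβ j)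
    refine ContinuousAt.comp (f := fun x : ℝ => max x 0 + β j)
      (Real.differentiableAt_Gamma fun m hm => ?_).continuousAt (by fun_prop)
    have := Nat.cast_nonneg (α := ℝ) m
    linarith
  refine ⟨Set.ordConnected_Ici, natMeasure fun k => c ^ k / (k.factorial : ℝ),
    fun j x => Real.Gamma (max x 0 + β j) / Real.Gamma (β j), ?_, fun j => (hcont j).measurable,
    fun j x _ => ?_, fun j => ?_, fun n => ⟨fun j => (hcont j).continuousOn, fun A hA hA0 => ?_⟩⟩
  · have : ∀ᵐ x ∂natMeasure fun k => c ^ k / (k.factorial : ℝ), 0 ≤ x :=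
      natMeasure_ae_iff.mpr fun k _ => Nat.cast_nonneg k
    exact this
  · have h : 0 < max x 0 + β j := add_pos_of_nonneg_of_pos (le_max_right _ _) (hβ j)
    exact (div_pos (Real.Gamma_pos_of_pos h) (hG j)).le
  · rw [natMeasure_withDensity (fun k => by positivity)]
    refine (meixnerMeasure_eq _ _).trans (congrArg _ (funext fun k => ?_))
    beta_reduce
    rw [max_eq_left (Nat.cast_nonneg k), add_comm, gamma_add_nat (hβ j), eval_ascPochhammer_eq,
      mul_div_cancel_right₀ _ (hG j).ne']
    ring
  · have h := encard_zeros_gamma_lt hβ hβ' n (A := fun j => C (1 / Real.Gamma (β j)) * A j)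
      (fun j => by rw [degree_C_mul (one_div_ne_zero (hG j).ne')]; exact hA j)
      (fun h => hA0 (funext fun j => by
        simpa [(hG j).ne'] using congrFun h j))
    convert h using 4 with x
    refine and_congr_right fun hx => Eq.congr (Finset.sum_congr rfl fun j _ => ?_) rfl
    beta_reduce
    rw [max_eq_left (Set.mem_Ici.mp hx), eval_mul, eval_C]
    ring

end

/-! ### The families -/

theorem hermite_spec {c : Fin r → ℝ} (hc : Function.Injective c) (n : Fin r → ℕ) :
    IsNormal (fun j => hermiteMeasure (c j)) n ∧
      NearestNeighborRecurrence (fun j => hermiteMeasure (c j)) n (hermiteB c n) (hermiteA n) ∧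
      (∀ j, 0 < n j → 0 < hermiteA n j) ∧
      ∀ k, Interlace (poly (fun j => hermiteMeasure (c j)) n)
        (upperPoly (fun j => hermiteMeasure (c j)) n k) := by
  obtain ⟨h1, h2⟩ := exp_family (isATSystem_hermite hc) (fun j => integrable_hermite (c j))
    (D := ∑ j, n j) (fun j p hp h => absurd h (not_ae_hermite hp)) fun j => integral_hermite (c j)
  obtain ⟨h3, h4⟩ := h2 n le_rfl
  refine ⟨h1 n (Nat.le_succ _), ?_, fun j hj => ?_, h4⟩
  · convert h3 using 1
    · funext k; simp [hermiteB]; ring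
    · funext j; simp [hermiteA]; ring
  · have : (0 : ℝ) < n j := by exact_mod_cast hj
    simp only [hermiteA]; positivity

theorem charlier_spec {a : Fin r → ℝ} (ha : ∀ j, 0 < a j) (hinj : Function.Injective a)
    (n : Fin r → ℕ) :
    IsNormal (fun j => charlierMeasure (a j)) n ∧
      NearestNeighborRecurrence (fun j => charlierMeasure (a j)) n
        (charlierB a n) (charlierA a n) ∧
      (∀ j, 0 < n j → 0 < charlierA a n j) ∧
      ∀ k, Interlace (poly (fun j => charlierMeasure (a j)) n)
        (upperPoly (fun j => charlierMeasure (a j)) n k) := by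
  obtain ⟨h1, h2⟩ := natMeasure_exp_family (W := fun j k => a j ^ k / (k.factorial : ℝ))
    (fun j k => by have := (ha j).le; positivity) (A := a) (B := fun _ => 0) (by simp)
    (fun j => charlier_pearson (a j)) (l := 1) (s₂ := 0) (z := a) (by simp) (by simp)
    (V := fun k => 1 / (k.factorial : ℝ)) (fun k => by positivity) (c := fun j => Real.log (a j))
    (K := fun _ => 1) (fun i j h => hinj (Real.log_injOn_pos (ha i) (ha j) h)) (by simp)
    (fun j k => by
      rw [mul_comm (Real.log _), Real.exp_nat_mul, Real.exp_log (ha j)]; ring)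
    (D := ∑ j, n j) (fun j k _ => by have := ha j; positivity)
    (fun j => charlierMeasure_eq (a j))
  obtain ⟨h3, h4⟩ := h2 n le_rfl
  refine ⟨h1 n (Nat.le_succ _), ?_, fun j hj => ?_, h4⟩
  · convert h3 using 1
    · funext k; simp [charlierB]
    · funext j; simp [charlierA]; ring
  · have : (0 : ℝ) < n j := by exact_mod_cast hj
    exact mul_pos (ha j) this

theorem meixner_first_spec {β : ℝ} {c : Fin r → ℝ} (hβ : 0 < β) (hc : ∀ j, 0 < c j ∧ c j < 1)
    (hinj : Function.Injective c) (n : Fin r → ℕ) :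
    IsNormal (fun j => meixnerMeasure β (c j)) n ∧
      NearestNeighborRecurrence (fun j => meixnerMeasure β (c j)) n
        (meixnerB β c n) (meixnerA β c n) ∧
      (∀ j, 0 < n j → 0 < meixnerA β c n j) ∧
      ∀ k, Interlace (poly (fun j => meixnerMeasure β (c j)) n)
        (upperPoly (fun j => meixnerMeasure β (c j)) n k) := by
  have hc0 := fun j => (hc j).1
  have hc1 : ∀ j, 1 - c j ≠ 0 := fun j => (sub_pos.mpr (hc j).2).ne'
  have hpos : ∀ k, 0 < (ascPochhammer ℝ k).eval β := fun k => ascPochhammer_pos k β hβ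
  obtain ⟨h1, h2⟩ := natMeasure_exp_family
    (W := fun j k => (ascPochhammer ℝ k).eval β * c j ^ k / (k.factorial : ℝ))
    (fun j k => by have := (hc0 j).le; have := (hpos k).le; positivity)
    (A := fun j => c j * β) (B := c) (fun j => (hc j).2)
    (fun j => meixner_pearson β (c j)) (l := β) (s₂ := 1) (z := fun j => c j / (1 - c j))
    (fun j => by have := hc1 j; field_simp) (fun j => by have := hc1 j; field_simp)
    (V := fun k => (ascPochhammer ℝ k).eval β / (k.factorial : ℝ))
    (fun k => by have := (hpos k).le; positivity) (c := fun j => Real.log (c j))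
    (K := fun _ => 1) (fun i j h => hinj (Real.log_injOn_pos (hc0 i) (hc0 j) h)) (by simp)
    (fun j k => by
      rw [mul_comm (Real.log _), Real.exp_nat_mul, Real.exp_log (hc0 j)]; ring)
    (D := ∑ j, n j) (fun j k _ => by have := hc0 j; have := hpos k; positivity)
    (fun j => meixnerMeasure_eq β (c j))
  obtain ⟨h3, h4⟩ := h2 n le_rfl
  refine ⟨h1 n (Nat.le_succ _), ?_, fun j hj => ?_, h4⟩
  · convert h3 using 1
    · funext k
      simp only [meixnerB]
      congr 1
      · ring
      · refine Finset.sum_congr rfl fun j _ => ?_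
        have := hc1 j
        field_simp
        ring
    · funext j
      simp only [meixnerA]
      have := hc1 j
      field_simp
      ring
  · have h5 : (1 : ℝ) ≤ n j := by exact_mod_cast hj
    have h6 : (n j : ℝ) ≤ ∑ i, (n i : ℝ) :=
      Finset.single_le_sum (f := fun i => (n i : ℝ)) (fun i _ => Nat.cast_nonneg _)
        (Finset.mem_univ j)
    -- The case `β < 1` is covered because `n j > 0` gives `|n| ≥ 1`.
    have h7 : 0 < β + (∑ i, (n i : ℝ)) - 1 := by linarith
    have h8 := hc0 j
    have h9 : 0 < 1 - c j := sub_pos.mpr (hc j).2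
    simp only [meixnerA]
    positivity

theorem krawtchouk_spec (N : ℕ) {p : Fin r → ℝ} (hp : ∀ j, 0 < p j ∧ p j < 1)
    (hinj : Function.Injective p) :
    (∀ n : Fin r → ℕ, ∑ i, n i ≤ N + 1 → IsNormal (fun j => krawtchoukMeasure N (p j)) n) ∧
      ∀ n : Fin r → ℕ, ∑ i, n i ≤ N →
        NearestNeighborRecurrence (fun j => krawtchoukMeasure N (p j)) n
          (krawtchoukB N p n) (krawtchoukA N p n) ∧
        (∀ j, 0 < n j → 0 < krawtchoukA N p n j) ∧
        ∀ k, Interlace (poly (fun j => krawtchoukMeasure N (p j)) n)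
          (upperPoly (fun j => krawtchoukMeasure N (p j)) n k) := by
  have hp0 := fun j => (hp j).1
  have hp1 : ∀ j, 0 < 1 - p j := fun j => sub_pos.mpr (hp j).2
  have hθ : ∀ j, 0 < p j / (1 - p j) := fun j => div_pos (hp0 j) (hp1 j)
  obtain ⟨h1, h2⟩ := natMeasure_exp_family
    (W := fun j k => (N.choose k : ℝ) * p j ^ k * (1 - p j) ^ (N - k))
    (fun j k => by have := (hp0 j).le; have := (hp1 j).le; positivity)
    -- With the odds `θ = p / (1 - p)` the Pearson coefficient is `θ (N - k)`. Since `1 + θ = 1 / (1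
    -- - p)`, the node is `p` itself, with `l = N` and `s₂ = -1`.
    (A := fun j => p j / (1 - p j) * N) (B := fun j => -(p j / (1 - p j)))
    (fun j => by linarith [hθ j])
    (fun j => krawtchouk_pearson N (hp j).2) (l := N) (s₂ := -1) (z := p)
    (fun j => by have := (hp1 j).ne'; field_simp; ring)
    (fun j => by have := (hp1 j).ne'; field_simp; ring)
    (V := fun k => (N.choose k : ℝ)) (fun k => by positivity)
    (c := fun j => Real.log (p j / (1 - p j))) (K := fun j => (1 - p j) ^ N)
    (fun i j h => hinj (by
      have h3 := Real.log_injOn_pos (hθ i) (hθ j) h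
      rw [div_eq_div_iff (hp1 i).ne' (hp1 j).ne'] at h3
      linarith))
    (fun j => pow_pos (hp1 j) N)
    (fun j k => by
      rw [mul_comm (Real.log _), Real.exp_nat_mul, Real.exp_log (hθ j), div_pow]
      rcases le_or_gt k N with hk | hk
      · have := (hp1 j).ne'
        obtain ⟨m, rfl⟩ := Nat.exists_eq_add_of_le hk
        rw [Nat.add_sub_cancel_left, pow_add]
        field_simp
      · simp [Nat.choose_eq_zero_of_lt hk])
    (D := N) (fun j k hk => by
      have := hp0 j
      have := hp1 j
      have : (0 : ℝ) < N.choose k := by exact_mod_cast Nat.choose_pos hk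
      positivity)
    (fun j => krawtchoukMeasure_eq N (p j))
  refine ⟨h1, fun n hn => ?_⟩
  obtain ⟨h3, h4⟩ := h2 n hn
  refine ⟨?_, fun j hj => ?_, h4⟩
  · convert h3 using 1
    · funext k
      simp only [krawtchoukB]
      congr 1
      · ring
      · exact Finset.sum_congr rfl fun j _ => by ring
    · funext j
      simp only [krawtchoukA]
      have : p j - 1 ≠ 0 := by linarith [hp1 j]
      field_simp
      ring
  · have h5 : (0 : ℝ) < n j := by exact_mod_cast hj
    have h6 : (∑ i, (n i : ℝ)) ≤ N := by exact_mod_cast hn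
    have h7 : p j - 1 < 0 := by linarith [hp1 j]
    -- The stated coefficient contains the two negative factors `p / (p - 1)` and `|n| - N - 1`;
    -- this form shows the positivity.
    have e : krawtchoukA N p n j = p j * (1 - p j) * n j * (N + 1 - ∑ i, (n i : ℝ)) := by
      simp only [krawtchoukA]
      have := h7.ne
      field_simp
      ring
    rw [e]
    exact mul_pos (mul_pos (mul_pos (hp0 j) (hp1 j)) h5) (by linarith)

theorem laguerre_second_spec {α : ℝ} {c : Fin r → ℝ} (hα : -1 < α) (hc : ∀ j, 0 < c j)
    (hinj : Function.Injective c) (n : Fin r → ℕ) :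
    IsNormal (fun j => laguerreMeasure α (c j)) n ∧
      NearestNeighborRecurrence (fun j => laguerreMeasure α (c j)) n
        (laguerreB α c n) (laguerreA α c n) ∧
      (∀ j, 0 < n j → 0 < laguerreA α c n j) ∧
      ∀ k, Interlace (poly (fun j => laguerreMeasure α (c j)) n)
        (upperPoly (fun j => laguerreMeasure α (c j)) n k) := by
  obtain ⟨h1, h2⟩ := exp_family (isATSystem_laguerre_second hinj)
    (fun j => integrable_laguerre hα (hc j))
    (D := ∑ j, n j) (fun j p hp h => absurd h (not_ae_laguerre hp))
    fun j => integral_laguerre hα (hc j)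
  obtain ⟨h3, h4⟩ := h2 n le_rfl
  refine ⟨h1 n (Nat.le_succ _), ?_, fun j hj => ?_, h4⟩
  · convert h3 using 1
    · funext k
      simp only [laguerreB]
      congr 1
      · ring
      · exact Finset.sum_congr rfl fun j _ => by ring
    · funext j
      simp only [laguerreA]
      ring
  · have h5 : (1 : ℝ) ≤ n j := by exact_mod_cast hj
    have h6 : (n j : ℝ) ≤ ∑ i, (n i : ℝ) :=
      Finset.single_le_sum (f := fun i => (n i : ℝ)) (fun i _ => Nat.cast_nonneg _)
        (Finset.mem_univ j)
    have h7 : 0 < (∑ i, (n i : ℝ)) + α := by linarith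
    have := hc j
    simp only [laguerreA]
    positivity

theorem laguerre_first_spec {α : Fin r → ℝ} (hα : ∀ j, -1 < α j)
    (hα' : ∀ i j, i ≠ j → ∀ z : ℤ, α i - α j ≠ (z : ℝ)) :
    IsATSystem (fun j => laguerreMeasure (α j) 1) (Set.Ioi 0) ∧
      ∀ n : Fin r → ℕ,
        IsNormal (fun j => laguerreMeasure (α j) 1) n ∧
        ∀ k, Interlace (poly (fun j => laguerreMeasure (α j) 1) n)
          (upperPoly (fun j => laguerreMeasure (α j) 1) n k) := by
  refine ⟨isATSystem_laguerre_first hα', fun n => ?_⟩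
  obtain ⟨h1, h2⟩ := (isATSystem_laguerre_first hα').isNormal_and_interlace
    (fun j => integrable_laguerre (hα j) one_pos)
    (D := ∑ j, n j) fun j p hp h => absurd h (not_ae_laguerre hp)
  exact ⟨h1 n (Nat.le_succ _), h2 n le_rfl⟩

theorem meixner_second_spec {β : Fin r → ℝ} {c : ℝ} (hβ : ∀ j, 0 < β j) (hc : 0 < c) (hc1 : c < 1)
    (hβ' : ∀ i j, i ≠ j → ∀ z : ℤ, β i - β j ≠ (z : ℝ)) :
    IsATSystem (fun j => meixnerMeasure (β j) c) (Set.Ici 0) ∧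
      ∀ n : Fin r → ℕ,
        IsNormal (fun j => meixnerMeasure (β j) c) n ∧
        ∀ k, Interlace (poly (fun j => meixnerMeasure (β j) c) n)
          (upperPoly (fun j => meixnerMeasure (β j) c) n k) := by
  refine ⟨isATSystem_meixner_second hβ hc hβ', fun n => ?_⟩
  have hpos : ∀ j k, 0 < (ascPochhammer ℝ k).eval (β j) * c ^ k / (k.factorial : ℝ) := fun j k => by
    have := ascPochhammer_pos k (β j) (hβ j)
    positivity
  obtain ⟨h1, h2⟩ := (isATSystem_meixner_second hβ hc hβ').isNormal_and_interlace
    (fun j => integrable_natMeasure (fun k => (hpos j k).le)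
      (summable_of_pearson (fun k => (hpos j k).le) hc1 (meixner_pearson (β j) c)))
    (D := ∑ j, n j) fun j p hp h => le_card_roots_of_ae_natMeasure (fun k _ => hpos j k) hp h
  exact ⟨h1 n (Nat.le_succ _), h2 n le_rfl⟩

end MOP

theorem mainTheorem5 (r : ℕ) :
    -- multiple Hermite polynomials
    (∀ c : Fin r → ℝ, Function.Injective c → ∀ n : Fin r → ℕ,
      MOP.IsNormal (fun j => MOP.hermiteMeasure (c j)) n ∧
      MOP.NearestNeighborRecurrence (fun j => MOP.hermiteMeasure (c j)) n
        (MOP.hermiteB c n) (MOP.hermiteA n) ∧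
      (∀ j, 0 < n j → 0 < MOP.hermiteA n j) ∧
      ∀ k, MOP.Interlace (MOP.poly (fun j => MOP.hermiteMeasure (c j)) n)
        (MOP.upperPoly (fun j => MOP.hermiteMeasure (c j)) n k)) ∧
    -- multiple Charlier polynomials
    (∀ a : Fin r → ℝ, (∀ j, 0 < a j) → Function.Injective a → ∀ n : Fin r → ℕ,
      MOP.IsNormal (fun j => MOP.charlierMeasure (a j)) n ∧
      MOP.NearestNeighborRecurrence (fun j => MOP.charlierMeasure (a j)) n
        (MOP.charlierB a n) (MOP.charlierA a n) ∧
      (∀ j, 0 < n j → 0 < MOP.charlierA a n j) ∧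
      ∀ k, MOP.Interlace (MOP.poly (fun j => MOP.charlierMeasure (a j)) n)
        (MOP.upperPoly (fun j => MOP.charlierMeasure (a j)) n k)) ∧
    -- multiple Meixner polynomials of the first kind
    (∀ (β : ℝ) (c : Fin r → ℝ), 0 < β → (∀ j, 0 < c j ∧ c j < 1) → Function.Injective c →
      ∀ n : Fin r → ℕ,
      MOP.IsNormal (fun j => MOP.meixnerMeasure β (c j)) n ∧
      MOP.NearestNeighborRecurrence (fun j => MOP.meixnerMeasure β (c j)) n
        (MOP.meixnerB β c n) (MOP.meixnerA β c n) ∧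
      (∀ j, 0 < n j → 0 < MOP.meixnerA β c n j) ∧
      ∀ k, MOP.Interlace (MOP.poly (fun j => MOP.meixnerMeasure β (c j)) n)
        (MOP.upperPoly (fun j => MOP.meixnerMeasure β (c j)) n k)) ∧
    -- multiple Krawtchouk polynomials
    (∀ (N : ℕ) (p : Fin r → ℝ), (∀ j, 0 < p j ∧ p j < 1) → Function.Injective p →
      (∀ n : Fin r → ℕ, ∑ i, n i ≤ N + 1 →
        MOP.IsNormal (fun j => MOP.krawtchoukMeasure N (p j)) n) ∧
      ∀ n : Fin r → ℕ, ∑ i, n i ≤ N →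
        MOP.NearestNeighborRecurrence (fun j => MOP.krawtchoukMeasure N (p j)) n
          (MOP.krawtchoukB N p n) (MOP.krawtchoukA N p n) ∧
        (∀ j, 0 < n j → 0 < MOP.krawtchoukA N p n j) ∧
        ∀ k, MOP.Interlace (MOP.poly (fun j => MOP.krawtchoukMeasure N (p j)) n)
          (MOP.upperPoly (fun j => MOP.krawtchoukMeasure N (p j)) n k)) ∧
    -- multiple Laguerre polynomials of the second kind
    (∀ (α : ℝ) (c : Fin r → ℝ), -1 < α → (∀ j, 0 < c j) → Function.Injective c →
      ∀ n : Fin r → ℕ,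
      MOP.IsNormal (fun j => MOP.laguerreMeasure α (c j)) n ∧
      MOP.NearestNeighborRecurrence (fun j => MOP.laguerreMeasure α (c j)) n
        (MOP.laguerreB α c n) (MOP.laguerreA α c n) ∧
      (∀ j, 0 < n j → 0 < MOP.laguerreA α c n j) ∧
      ∀ k, MOP.Interlace (MOP.poly (fun j => MOP.laguerreMeasure α (c j)) n)
        (MOP.upperPoly (fun j => MOP.laguerreMeasure α (c j)) n k)) ∧
    -- multiple Laguerre polynomials of the first kind
    (∀ α : Fin r → ℝ, (∀ j, -1 < α j) →
      (∀ i j, i ≠ j → ∀ z : ℤ, α i - α j ≠ (z : ℝ)) →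
      MOP.IsATSystem (fun j => MOP.laguerreMeasure (α j) 1) (Set.Ioi 0) ∧
      ∀ n : Fin r → ℕ,
        MOP.IsNormal (fun j => MOP.laguerreMeasure (α j) 1) n ∧
        ∀ k, MOP.Interlace (MOP.poly (fun j => MOP.laguerreMeasure (α j) 1) n)
          (MOP.upperPoly (fun j => MOP.laguerreMeasure (α j) 1) n k)) ∧
    -- multiple Meixner polynomials of the second kind
    (∀ (β : Fin r → ℝ) (c : ℝ), (∀ j, 0 < β j) → 0 < c → c < 1 →
      (∀ i j, i ≠ j → ∀ z : ℤ, β i - β j ≠ (z : ℝ)) →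
      MOP.IsATSystem (fun j => MOP.meixnerMeasure (β j) c) (Set.Ici 0) ∧
      ∀ n : Fin r → ℕ,
        MOP.IsNormal (fun j => MOP.meixnerMeasure (β j) c) n ∧
        ∀ k, MOP.Interlace (MOP.poly (fun j => MOP.meixnerMeasure (β j) c) n)
          (MOP.upperPoly (fun j => MOP.meixnerMeasure (β j) c) n k)) :=
  ⟨fun _ hc n => MOP.hermite_spec hc n, fun _ ha hinj n => MOP.charlier_spec ha hinj n,
    fun _ _ hβ hc hinj n => MOP.meixner_first_spec hβ hc hinj n,
    fun N _ hp hinj => MOP.krawtchouk_spec N hp hinj,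
    fun _ _ hα hc hinj n => MOP.laguerre_second_spec hα hc hinj n,
    fun _ hα hα' => MOP.laguerre_first_spec hα hα',
    fun _ _ hβ hc hc1 hβ' => MOP.meixner_second_spec hβ hc hc1 hβ'⟩
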